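/- Let $\mathcal X\subset\mathbb R^d$ and $\mathcal U\subset\mathbb R^p$ be finite and non-empty, $\mathcal Z=\mathcal X\times\mathcal U$, $N_z=|\mathcal Z|$, let $k(z,z')=\exp(-\gamma\|z-z'\|^2)$ with $\gamma>0$, let $N\ge 1$ be the episode length, $f$ the unknown dynamics and $p_0$ a prior model of it. Points $z^{\tau,n}=(x^{\tau,n},u^{\tau,n})\in\mathcal Z$ are sampled successively in episodes $\tau=1,2,\dots$ at iterations $n=0,\dots,N-1$, and $y^{\tau,n}=f(z^{\tau,n})+w^{\tau,n}$ is observed, where the noise $w^{\tau,n}$ is Gaussian $\mathcal N(0,vI)$, independent of the past and of $z^{\tau,n}$, with a variance $v=v_{\tau,n}\ge 0$ that is bounded uniformly in $\tau$ and $n$ (it may be constant or decreasing). When $M=(\tau-1)N+n$ data points $(z^i,y^i)$ have been observed, let $\sigma^2=M^{-2}=((\tau-1)N+n)^{-2}$, $G=(k(z^i,z^j))_{i,j}$, $\boldsymbol k_z=(k(z^i,z))_i$ and $$\mu_{\tau,n}(z)=(\boldsymbol y-\boldsymbol m_\tau)^\top(G+\sigma^2I)^{-1}\boldsymbol k_z+m_\tau(z)\quad(n\ge1),\qquad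 \sigma^2_{\tau,n}(z)=k(z,z)-\boldsymbol k_z^\top(G+\sigma^2I)^{-1}\boldsymbol k_z ,$$ where $\boldsymbol m_\tau=(m_\tau(z^i))_i$, $\sigma^2_{1,0}(z)=k(z,z)$, $m_1=p_0$, $m_{\tau+1}=\mu_{\tau,N}$ and $\mu_{\tau,0}=m_\tau$. The action $u^{\tau,n}$ is the first action $u_0$ of a maximizer $(u_0,\dots,u_{N-1})\in\mathcal U^N$ of $\sum_{t=0}^{N-1}A_{\tau,n}(x_t,u_t)$ subject to $x_0=x^{\tau,n}$, $x_{t+1}=\mu_{\tau,n}(x_t,u_t)$, with the discrepancy-based GP-UCB acquisition function $A_{\tau,n}(z)=\|\mu_{\tau,n}(z)-m_\tau(z)\|+\beta_{\tau,n}^{1/2}\sigma_{\tau,n}(z)$, $\beta_{\tau,n}\ge0$. Assume that in every episode $\tau$ there is an $n_*\in\{0,\dots,N-1\}$ with $$\sigma^2_{\tau,n_*}(z^{\tau,n_*})\ \ge\ \frac1{N_z}\sum_{z\in\mathcal Z}\sigma^2_{\tau,n_*}(z).$$ Then $\max_{z\in\mathcal Z}\sigma^2_{\tau,0}(z)\to0$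 as $\tau\to\infty$. Moreover, for every $\varepsilon>0$, $\max_{z\in\mathcal Z}\sigma^2_{\tau,0}(z)\le\varepsilon$ for every episode $\tau$ with $$\tau\ \ge\ \frac{N_z(N_z-\varepsilon)}{N^2\varepsilon}+N_z\log\frac{N_z}{\varepsilon},$$ provided that $\tau\ge3$ or $N_z\ge3$. If in addition every coordinate $f_\ell$ lies in the ball of radius $B$ of the reproducing kernel Hilbert space on $\mathcal Z$ with kernel $k$, then, almost surely, $\mu_{\tau,0}(z)\to f(z)$ as $\tau\to\infty$ for every $z\in\mathcal Z$. -/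

import Mathlib

open MeasureTheory ProbabilityTheory Filter Topology
open scoped NNReal Matrix

noncomputable section

namespace ActiveGP

/-- States are vectors in `ℝ^d`, actions are vectors in `ℝ^p`, both with the Euclidean norm. -/
abbrev Vec (d : ℕ) : Type := EuclideanSpace ℝ (Fin d)

/-- Ambient space of the state-action pairs `z = (x, u)`. -/
abbrev StateAction (d p : ℕ) : Type := Vec d × Vec p

variable {d p : ℕ}

/-- The squared exponential kernel `k(z, z') = exp (-γ ‖z - z'‖²)`, where `‖·‖` is the Euclidean
norm of `ℝ^(d+p)` (the norm that Mathlib puts on a product is the maximum norm, so the Euclidean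
norm is written out). -/
def rbf (γ : ℝ) (z z' : StateAction d p) : ℝ :=
  Real.exp (-γ * (‖z.1 - z'.1‖ ^ 2 + ‖z.2 - z'.2‖ ^ 2))

/-! ### Gaussian process regression

`z 0, z 1, …` and `y 0, y 1, …` are the successive sampled points and observations. -/

/-- Gram matrix of the first `m` sampled points. -/
def gram (γ : ℝ) (z : ℕ → StateAction d p) (m : ℕ) : Matrix (Fin m) (Fin m) ℝ :=
  Matrix.of fun i j => rbf γ (z i) (z j)

/-- The vector `(k(z^i, zs))_i`. -/
def kernelVec (γ : ℝ) (z : ℕ → StateAction d p) (m : ℕ) (zs : StateAction d p) : Fin m → ℝ :=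
  fun i => rbf γ (z i) zs

/-- The regularization parameter `σ² = m⁻²` that is used with a data set of `m` points. -/
def reg (m : ℕ) : ℝ := ((m : ℝ) ^ 2)⁻¹

/-- `(G + σ² I)⁻¹` for the first `m` data points. -/
def precision (γ : ℝ) (z : ℕ → StateAction d p) (m : ℕ) : Matrix (Fin m) (Fin m) ℝ :=
  (gram γ z m + reg m • (1 : Matrix (Fin m) (Fin m) ℝ))⁻¹

/-- Predictive variance at `zs` given the first `m` data points. -/
def postVar (γ : ℝ) (z : ℕ → StateAction d p) (m : ℕ) (zs : StateAction d p) : ℝ :=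
  rbf γ zs zs - kernelVec γ z m zs ⬝ᵥ (precision γ z m *ᵥ kernelVec γ z m zs)

/-- Predictive mean at `zs` given the first `m` data points and the prior mean function `μ₀`;
the formula is applied to each of the `d` coordinates. -/
def postMean (γ : ℝ) (z : ℕ → StateAction d p) (y : ℕ → Vec d) (μ₀ : StateAction d p → Vec d)
    (m : ℕ) (zs : StateAction d p) : Vec d :=
  WithLp.toLp 2 fun l =>
    (fun i : Fin m => y i l - μ₀ (z i) l) ⬝ᵥ (precision γ z m *ᵥ kernelVec γ z m zs) + μ₀ zs l

/-! ### The episodic model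

Episodes are `τ = 1, 2, …`, each consists of the iterations `n = 0, …, N - 1`. -/

/-- Number of data points observed before iteration `n` of episode `τ`. It is also the position,
in the whole sequence of samples, of the point `z^{τ,n}` sampled at that iteration. -/
def idx (N τ n : ℕ) : ℕ := (τ - 1) * N + n

/-- The prior `m_τ` of episode `τ`: `m_1 = p0` and `m_{τ+1} = μ_{τ,N}`. The value at `τ = 0` is
not used. -/
def episodePrior (N : ℕ) (γ : ℝ) (p0 : StateAction d p → Vec d) (z : ℕ → StateAction d p)
    (y : ℕ → Vec d) : ℕ → StateAction d p → Vec d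
  | 0 => p0
  | 1 => p0
  | τ + 2 => postMean γ z y (episodePrior N γ p0 z y (τ + 1)) (idx N (τ + 1) N)

/-- The predictive mean `μ_{τ,n}`, with `μ_{τ,0} = μ_{τ-1,N} = m_τ`. -/
def predMean (N : ℕ) (γ : ℝ) (p0 : StateAction d p → Vec d) (z : ℕ → StateAction d p)
    (y : ℕ → Vec d) (τ n : ℕ) : StateAction d p → Vec d :=
  if n = 0 then episodePrior N γ p0 z y τ
  else postMean γ z y (episodePrior N γ p0 z y τ) (idx N τ n)

/-- The predictive variance `σ²_{τ,n}`; since `idx N (τ + 1) 0 = idx N τ N`, it satisfies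
`σ²_{τ+1,0} = σ²_{τ,N}` for `1 ≤ τ`. -/
def predVar (N : ℕ) (γ : ℝ) (z : ℕ → StateAction d p) (τ n : ℕ) (zs : StateAction d p) : ℝ :=
  postVar γ z (idx N τ n) zs

/-! ### Planning with the discrepancy-based GP-UCB acquisition function -/

/-- The acquisition function
`|μ_{τ,n}(zs) - m_τ(zs)| + β_{τ,n}^{1/2} σ_{τ,n}(zs)` (without further side information). -/
def acquisition (N : ℕ) (γ : ℝ) (p0 : StateAction d p → Vec d) (β : ℕ → ℕ → ℝ)
    (z : ℕ → StateAction d p) (y : ℕ → Vec d) (τ n : ℕ) (zs : StateAction d p) : ℝ :=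
  ‖predMean N γ p0 z y τ n zs - episodePrior N γ p0 z y τ zs‖
    + √(β τ n) * √(predVar N γ z τ n zs)

/-- The predicted trajectory: `x_0 = x₀`, `x_{t+1} = μ (x_t, u_t)`. -/
def rollout (μ : StateAction d p → Vec d) (x₀ : Vec d) (u : ℕ → Vec p) : ℕ → Vec d
  | 0 => x₀
  | t + 1 => μ (rollout μ x₀ u t, u t)

/-- The planning objective: the acquisition function summed along the predicted trajectory over
the horizon `N`. -/
def planValue (N : ℕ) (γ : ℝ) (p0 : StateAction d p → Vec d) (β : ℕ → ℕ → ℝ)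
    (z : ℕ → StateAction d p) (y : ℕ → Vec d) (τ n : ℕ) (x₀ : Vec d) (u : ℕ → Vec p) : ℝ :=
  ∑ t ∈ Finset.range N,
    acquisition N γ p0 β z y τ n (rollout (predMean N γ p0 z y τ n) x₀ u t, u t)

/-- `u_0, …, u_{N-1}` is a sequence of actions in `U` that solves the planning problem from `x₀`
at iteration `n` of episode `τ`. -/
def IsOptimalPlan (U : Finset (Vec p)) (N : ℕ) (γ : ℝ) (p0 : StateAction d p → Vec d)
    (β : ℕ → ℕ → ℝ) (z : ℕ → StateAction d p) (y : ℕ → Vec d) (τ n : ℕ) (x₀ : Vec d)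
    (u : ℕ → Vec p) : Prop :=
  (∀ t < N, u t ∈ U) ∧
    ∀ v : ℕ → Vec p, (∀ t < N, v t ∈ U) →
      planValue N γ p0 β z y τ n x₀ v ≤ planValue N γ p0 β z y τ n x₀ u

/-- The sampled states lie in `X`, and at every iteration the executed action is the first action
of a solution of the planning problem that starts at the current state. -/
structure IsUCBRun (X : Finset (Vec d)) (U : Finset (Vec p)) (N : ℕ) (γ : ℝ)
    (p0 : StateAction d p → Vec d) (β : ℕ → ℕ → ℝ)
    (z : ℕ → StateAction d p) (y : ℕ → Vec d) : Prop where
  state_mem : ∀ τ n, 1 ≤ τ → n < N → (z (idx N τ n)).1 ∈ X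
  action_eq : ∀ τ n, 1 ≤ τ → n < N →
    ∃ u, IsOptimalPlan U N γ p0 β z y τ n (z (idx N τ n)).1 u ∧ (z (idx N τ n)).2 = u 0

/-- In every episode some sampled point has, when it is sampled, a predictive variance that is at
least the average predictive variance over the state-action space `Z`. -/
def AboveAverage (Z : Finset (StateAction d p)) (N : ℕ) (γ : ℝ)
    (z : ℕ → StateAction d p) : Prop :=
  ∀ τ, 1 ≤ τ → ∃ n < N,
    (1 / (Z.card : ℝ)) * ∑ zs ∈ Z, predVar N γ z τ n zs ≤ predVar N γ z τ n (z (idx N τ n))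

/-- `N_z (N_z - ε) / (N² ε) + N_z log (N_z / ε)`. -/
def episodeBound (Nz N : ℕ) (ε : ℝ) : ℝ :=
  (Nz : ℝ) * (Nz - ε) / ((N : ℝ) ^ 2 * ε) + Nz * Real.log (Nz / ε)

/-- `g` belongs to the ball of radius `B` of the reproducing kernel Hilbert space of real functions
on `T` with kernel `k`. -/
def MemRKHSBall {T : Type} (k : T → T → ℝ) (B : ℝ) (g : T → ℝ) : Prop :=
  ∃ (H : Type) (_ : NormedAddCommGroup H) (_ : InnerProductSpace ℝ H) (_ : CompleteSpace H)
    (_ : RKHS ℝ H T ℝ),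
    (∀ s t, RKHS.kernel H s t 1 = k s t) ∧ ∃ h : H, (∀ t, h t = g t) ∧ ‖h‖ ≤ B

end ActiveGP

end

open ActiveGP

/-!
The squared exponential kernel is the inner product of Gaussian bumps in `L²`
(`exists_featureMap`). The predictive variance with `m` data points is therefore the minimal value
of a regularized least squares problem in that Hilbert space (`postVar_eq`, `postVar_le`), with
regularization `reg m = m⁻²`. As `reg` decreases, the variance decreases in `m`, although the
posterior at `m + 1` is not the Bayesian update of the posterior at `m`. A point with `j` visits has
variance at most `1 / (1 + j m²)` (`postVar_le_of_visits`); since the regularization at the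
*current* `m` applies to all earlier data, a single visit makes the variance tiny.

*Variance.* Once there have been more than `N_z` episodes, either all points of `Z` have been
visited, or, by the pigeonhole principle, one of the above-average points of the last `N_z` episodes
had been visited before; then the average variance was at most the tiny variance of a visited point
(`predVar_le_or`). For `ε < 1` the episode bound exceeds `N_z log N_z`, and its first summand
dominates what is needed in both cases (`predVar_le_of_episodeBound_le`). For `1 ≤ ε` there is
nothing to show, as the variance never exceeds `1`.

*Mean.* The kernel is strictly positive definite (`linearIndependent_featureMap`), so there is an
element `g x` of the Hilbert space that is `1` at `x` and `0` on the rest of `Z` (`exists_dual`); in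
particular every function on `Z`, such as `f` or the arbitrary prior `p0`, is in the reproducing
kernel Hilbert space. Duality gives a lower bound `1 / (κ + j m²)` of the variance
(`one_le_mul_postVar`), which matches the upper bound up to constants. Hence an above-average point
cannot have been visited much more often than any other point, and every point is visited linearly
often (`exists_visits_ge`). The error of the next prior is the smoothing error of the current one,
which is at most a vanishing multiple of the current error, plus a combination of the noise sums at
the points of `Z`, divided by numbers of visits that grow linearly (`episodePrior_succ_sub`,
`sub_sum_weight_eq`, `sum_mul_weight_eq`). These normalized noise sums tend to zero almost surely by
an `L²` martingale argument (`ae_tendsto_noise_average`), so the error tends to zero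
(`tendsto_predMean`).
-/

namespace ActiveGP

/-! ### A feature map of the squared exponential kernel -/

section FeatureMap

variable {d p : ℕ} {γ : ℝ}

theorem rbf_self (γ : ℝ) (x : StateAction d p) : rbf γ x x = 1 := by
  simp [rbf]

theorem rbf_comm (γ : ℝ) (x y : StateAction d p) : rbf γ x y = rbf γ y x := by
  simp only [rbf, norm_sub_rev x.1, norm_sub_rev x.2]

theorem rbf_zero_right (γ : ℝ) (t : StateAction d p) :
    rbf γ t 0 = Real.exp (-γ * ‖t.1‖ ^ 2) * Real.exp (-γ * ‖t.2‖ ^ 2) := by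
  rw [← Real.exp_add, rbf]
  congr 1
  simp
  ring

/-- The product of two Gaussian bumps is a Gaussian bump around the midpoint of their centres. -/
theorem rbf_mul_rbf (γ : ℝ) (x y t : StateAction d p) :
    rbf (2 * γ) x t * rbf (2 * γ) y t =
      rbf γ x y * rbf (4 * γ) (t - (1 / 2 : ℝ) • (x + y)) 0 := by
  have key : ∀ {n : ℕ} (a b c : Vec n), 2 * (‖a - c‖ ^ 2 + ‖b - c‖ ^ 2) =
      ‖a - b‖ ^ 2 + 4 * ‖c - (1 / 2 : ℝ) • (a + b)‖ ^ 2 := by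
    intro n a b c
    have h1 : a - b = (a - c) - (b - c) := by abel
    have h2 : c - (1 / 2 : ℝ) • (a + b) = -((1 / 2 : ℝ) • ((a - c) + (b - c))) := by
      module
    rw [h1, h2, norm_neg, norm_smul, mul_pow, @norm_sub_sq_real _ _ _ (a - c) (b - c),
      @norm_add_sq_real _ _ _ (a - c) (b - c)]
    norm_num
    ring
  have h1 := key x.1 y.1 t.1
  have h2 := key x.2 y.2 t.2
  simp only [rbf, ← Real.exp_add, sub_zero, Prod.fst_sub, Prod.snd_sub, Prod.smul_fst,
    Prod.smul_snd, Prod.fst_add, Prod.snd_add, Prod.fst_zero, Prod.snd_zero]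
  congr 1
  linear_combination (-γ) * h1 + (-γ) * h2

theorem integrable_rbf_zero_right (hγ : 0 < γ) :
    Integrable (fun t : StateAction d p => rbf γ t 0) := by
  have h : ∀ n : ℕ, Integrable (fun t : Vec n => Real.exp (-γ * ‖t‖ ^ 2)) := by
    intro n
    have := (GaussianFourier.integrable_cexp_neg_mul_sq_norm_add (V := Vec n)
      (b := (γ : ℂ)) (by simpa using hγ) 0 0).re
    refine this.congr (ae_of_all _ fun t => ?_)
    simp only [zero_mul, add_zero]
    have : (-(γ : ℂ) * (‖t‖ : ℂ) ^ 2) = ((-γ * ‖t‖ ^ 2 : ℝ) : ℂ) := by push_cast; rfl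
    rw [this, ← Complex.ofReal_exp]
    exact RCLike.ofReal_re_ax _
  simp only [rbf_zero_right]
  exact (h d).mul_prod (h p)

theorem integral_rbf_zero_right_pos (hγ : 0 < γ) :
    0 < ∫ t : StateAction d p, rbf γ t 0 := by
  refine integral_pos_of_integrable_nonneg_nonzero (x := 0) ?_ (integrable_rbf_zero_right hγ)
    (fun t => (Real.exp_pos _).le) (Real.exp_pos _).ne'
  unfold rbf
  fun_prop

/-- The kernel is the inner product, in the space of square integrable functions, of Gaussian
bumps with the parameter `2 * γ`. -/
theorem exists_featureMap (d p : ℕ) (hγ : 0 < γ) :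
    ∃ φ : StateAction d p → Lp ℝ 2 (volume : Measure (StateAction d p)),
      ∀ x y, inner ℝ (φ x) (φ y) = rbf γ x y := by
  have hpos := integral_rbf_zero_right_pos (d := d) (p := p) (γ := 4 * γ) (by positivity)
  have hint := integrable_rbf_zero_right (d := d) (p := p) (γ := 4 * γ) (by positivity)
  have : (volume : Measure (StateAction d p)).IsAddLeftInvariant :=
    inferInstanceAs ((volume : Measure (Vec d)).prod (volume : Measure (Vec p))).IsAddLeftInvariant
  set I := ∫ t : StateAction d p, rbf (4 * γ) t 0
  have hmul : ∀ x y : StateAction d p,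
      Integrable (fun t => rbf (2 * γ) x t * rbf (2 * γ) y t) := by
    intro x y
    simp only [rbf_mul_rbf]
    exact (hint.comp_sub_right _).const_mul _
  have hmem : ∀ x : StateAction d p, MemLp (fun t => (√I)⁻¹ * rbf (2 * γ) x t) 2 volume := by
    intro x
    refine MemLp.const_mul ?_ _
    rw [memLp_two_iff_integrable_sq]
    · simpa only [sq] using hmul x x
    · refine Continuous.aestronglyMeasurable ?_
      unfold rbf
      fun_prop
  refine ⟨fun x => (hmem x).toLp _, fun x y => ?_⟩
  rw [L2.inner_def]
  have : ∀ᵐ t, inner ℝ ((hmem x).toLp _ t) ((hmem y).toLp _ t) =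
      I⁻¹ * (rbf γ x y * rbf (4 * γ) (t - (1 / 2 : ℝ) • (x + y)) 0) := by
    filter_upwards [(hmem x).coeFn_toLp, (hmem y).coeFn_toLp] with t h1 h2
    rw [h1, h2, ← rbf_mul_rbf]
    have hI : (√I)⁻¹ * (√I)⁻¹ = I⁻¹ := by rw [← mul_inv, Real.mul_self_sqrt hpos.le]
    simp only [RCLike.inner_apply, conj_trivial]
    linear_combination (rbf (2 * γ) x t * rbf (2 * γ) y t) * hI
  rw [integral_congr_ae this, integral_const_mul, integral_const_mul,
    integral_sub_right_eq_self (fun t : StateAction d p => rbf (4 * γ) t 0)]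
  change I⁻¹ * (rbf γ x y * I) = _
  field_simp

variable {H : Type*} [NormedAddCommGroup H] [InnerProductSpace ℝ H]
  {φ : StateAction d p → H}

/-- The kernel is strictly positive definite: up to the nonzero factors `exp (-γ ‖x‖²)`, the
functions `rbf γ x` are distinct characters of the additive group, so they are linearly independent
by Dedekind's theorem. -/
theorem linearIndependent_featureMap (hγ : 0 < γ)
    (hφ : ∀ x y, inner ℝ (φ x) (φ y) = rbf γ x y) : LinearIndependent ℝ φ := by
  let χ : StateAction d p → (Multiplicative (StateAction d p) →* ℝ) := fun x =>
    { toFun := fun t => Real.exp (2 * γ * (inner ℝ x.1 t.toAdd.1 + inner ℝ x.2 t.toAdd.2))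
      map_one' := by simp
      map_mul' := fun s t => by
        rw [← Real.exp_add]
        congr 1
        simp only [toAdd_mul, Prod.fst_add, Prod.snd_add, inner_add_right]
        ring }
  have hχ : Function.Injective χ := by
    intro x y hxy
    have h : ∀ t : StateAction d p,
        inner ℝ x.1 t.1 + inner ℝ x.2 t.2 = (inner ℝ y.1 t.1 + inner ℝ y.2 t.2 : ℝ) := by
      intro t
      have := DFunLike.congr_fun hxy (Multiplicative.ofAdd t)
      have := Real.exp_injective this
      simpa [hγ.ne'] using this
    refine Prod.ext (ext_inner_right ℝ fun t => ?_) (ext_inner_right ℝ fun t => ?_)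
    · simpa using h (t, 0)
    · simpa using h (0, t)
  have hli := (linearIndependent_monoidHom (Multiplicative (StateAction d p)) ℝ).comp χ hχ
  rw [linearIndependent_iff'] at hli ⊢
  intro s c hc x hx
  have h0 := hli s (fun x => c x * Real.exp (-γ * (‖x.1‖ ^ 2 + ‖x.2‖ ^ 2))) (by
    funext t
    have h1 : inner ℝ (∑ i ∈ s, c i • φ i) (φ t.toAdd) = 0 := by rw [hc, inner_zero_left]
    simp only [sum_inner, real_inner_smul_left, hφ] at h1
    have h2 : ∀ i : StateAction d p, rbf γ i t.toAdd =
        Real.exp (-γ * (‖i.1‖ ^ 2 + ‖i.2‖ ^ 2)) * χ i t *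
          Real.exp (-γ * (‖t.toAdd.1‖ ^ 2 + ‖t.toAdd.2‖ ^ 2)) := by
      intro i
      change _ = _ * Real.exp (2 * γ * (inner ℝ i.1 t.toAdd.1 + inner ℝ i.2 t.toAdd.2)) * _
      rw [← Real.exp_add, ← Real.exp_add, rbf, norm_sub_sq_real, norm_sub_sq_real]
      congr 1
      ring
    have h3 : (∑ i ∈ s, c i * Real.exp (-γ * (‖i.1‖ ^ 2 + ‖i.2‖ ^ 2)) * χ i t) *
        Real.exp (-γ * (‖t.toAdd.1‖ ^ 2 + ‖t.toAdd.2‖ ^ 2)) = 0 := by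
      rw [Finset.sum_mul, ← h1]
      refine Finset.sum_congr rfl fun i _ => ?_
      rw [h2]
      ring
    have h4 := (mul_eq_zero.mp h3).resolve_right (Real.exp_pos _).ne'
    simpa [Finset.sum_apply] using h4) x hx
  exact (mul_eq_zero.mp h0).resolve_right (Real.exp_pos _).ne'

open scoped Classical in
/-- A family that is dual to the features of a finite set. Through the inner product with the
features, `g x` is the element of the reproducing kernel Hilbert space that is `1` at `x` and
vanishes at the other points of `Z`. -/
theorem exists_dual (hγ : 0 < γ) (hφ : ∀ x y, inner ℝ (φ x) (φ y) = rbf γ x y)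
    (Z : Finset (StateAction d p)) :
    ∃ g : StateAction d p → H, ∀ x ∈ Z, ∀ y ∈ Z,
      inner ℝ (g x) (φ y) = if x = y then 1 else 0 := by
  let ψ : Z → H := fun x => φ x
  have hψ : LinearIndependent ℝ ψ :=
    (linearIndependent_featureMap hγ hφ).comp _ Subtype.val_injective
  have hdet := (Matrix.det_gram_ne_zero_iff_linearIndependent (𝕜 := ℝ)).mpr hψ
  have hinv : (Matrix.gram ℝ ψ)⁻¹ * Matrix.gram ℝ ψ = 1 :=
    Matrix.nonsing_inv_mul _ (isUnit_iff_ne_zero.mpr hdet)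
  refine ⟨fun x => if hx : x ∈ Z then ∑ y : Z, (Matrix.gram ℝ ψ)⁻¹ ⟨x, hx⟩ y • ψ y else 0,
    fun x hx y hy => ?_⟩
  have h := congrFun (congrFun hinv ⟨x, hx⟩) ⟨y, hy⟩
  rw [Matrix.mul_apply, Matrix.one_apply] at h
  simp only [Subtype.mk.injEq] at h
  simp only [dif_pos hx]
  rw [sum_inner, ← h]
  exact Finset.sum_congr rfl fun i _ => by rw [real_inner_smul_left]; rfl

end FeatureMap

/-! ### Predictive variance and regularized least squares -/

section Variance

variable {d p : ℕ} {γ : ℝ} {z : ℕ → StateAction d p} {m : ℕ} {x zs : StateAction d p}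

/-- The regression weights: with `m` data points, the prediction at `zs` of a function with values
`h i` at the sampled points is `∑ i < m, h i * weight γ z m zs i`. The weights are indexed by `ℕ`
and vanish from `m` on. -/
noncomputable def weight (γ : ℝ) (z : ℕ → StateAction d p) (m : ℕ) (zs : StateAction d p)
    (i : ℕ) : ℝ :=
  if h : i < m then (precision γ z m *ᵥ kernelVec γ z m zs) ⟨i, h⟩ else 0

open scoped Classical in
/-- Number of times that `x` occurs among the first `m` sampled points. -/
noncomputable def visits (z : ℕ → StateAction d p) (m : ℕ) (x : StateAction d p) : ℕ :=
  ((Finset.range m).filter fun i => z i = x).card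

theorem dotProduct_precision (h : ℕ → ℝ) :
    (fun i : Fin m => h i) ⬝ᵥ (precision γ z m *ᵥ kernelVec γ z m zs) =
      ∑ i ∈ Finset.range m, h i * weight γ z m zs i := by
  rw [Finset.sum_range, dotProduct]
  exact Finset.sum_congr rfl fun i _ => by simp [weight]

theorem postVar_eq_sub_sum :
    postVar γ z m zs =
      rbf γ zs zs - ∑ i ∈ Finset.range m, rbf γ (z i) zs * weight γ z m zs i := by
  rw [← dotProduct_precision fun i => rbf γ (z i) zs]
  rfl

theorem reg_nonneg (m : ℕ) : 0 ≤ reg m := by unfold reg; positivity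

theorem reg_pos (hm : 0 < m) : 0 < reg m := by unfold reg; positivity

theorem reg_anti {m n : ℕ} (hm : 0 < m) (h : m ≤ n) : reg n ≤ reg m := by
  unfold reg; gcongr

theorem sq_mul_reg (hm : 0 < m) : (m : ℝ) ^ 2 * reg m = 1 := by
  unfold reg
  have : (m : ℝ) ≠ 0 := by positivity
  field_simp

variable {H : Type*} [NormedAddCommGroup H] [InnerProductSpace ℝ H]
  {φ : StateAction d p → H}

/-- The error of the regularized least squares approximation of the feature of `zs` by the features
of the first `m` sampled points. Its inner product with the feature of `x` is the posterior
covariance of the values at `zs` and `x`. -/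
noncomputable def residual (γ : ℝ) (φ : StateAction d p → H) (z : ℕ → StateAction d p) (m : ℕ)
    (zs : StateAction d p) : H :=
  φ zs - ∑ i ∈ Finset.range m, weight γ z m zs i • φ (z i)

/-- The normal equations of regularized least squares. -/
theorem inner_residual_sample (hφ : ∀ x y, inner ℝ (φ x) (φ y) = rbf γ x y) {i : ℕ}
    (hi : i < m) :
    inner ℝ (residual γ φ z m zs) (φ (z i)) = reg m * weight γ z m zs i := by
  have hgram : gram γ z m = Matrix.gram ℝ (fun i : Fin m => φ (z i)) := by
    ext a b
    simp [gram, Matrix.gram_apply, hφ]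
  have hpd : (gram γ z m + reg m • (1 : Matrix (Fin m) (Fin m) ℝ)).PosDef := by
    rw [hgram]
    exact Matrix.PosDef.posSemidef_add (Matrix.posSemidef_gram _ _)
      (Matrix.PosDef.one.smul (reg_pos (by omega)))
  have hinv : (gram γ z m + reg m • (1 : Matrix (Fin m) (Fin m) ℝ)) * precision γ z m = 1 :=
    Matrix.mul_nonsing_inv _ hpd.det_pos.ne'.isUnit
  have h := congrFun (congrArg (· *ᵥ kernelVec γ z m zs) hinv) ⟨i, hi⟩
  simp only [← Matrix.mulVec_mulVec, Matrix.add_mulVec, Matrix.one_mulVec, Matrix.smul_mulVec,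
    Pi.add_apply, Pi.smul_apply, smul_eq_mul] at h
  have h2 : (gram γ z m *ᵥ (precision γ z m *ᵥ kernelVec γ z m zs)) ⟨i, hi⟩ =
      ∑ j ∈ Finset.range m, rbf γ (z i) (z j) * weight γ z m zs j := by
    rw [← dotProduct_precision fun j => rbf γ (z i) (z j)]
    rfl
  have h3 : (precision γ z m *ᵥ kernelVec γ z m zs) ⟨i, hi⟩ = weight γ z m zs i := by
    rw [weight, dif_pos hi]
  rw [h2, h3] at h
  change _ = rbf γ (z i) zs at h
  rw [residual, inner_sub_left, sum_inner, hφ, rbf_comm, ← h]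
  simp only [real_inner_smul_left, hφ, rbf_comm γ (z i), mul_comm]
  ring

/-- The predictive variance is the minimal value of the regularized least squares objective. -/
theorem postVar_eq (hφ : ∀ x y, inner ℝ (φ x) (φ y) = rbf γ x y) :
    postVar γ z m zs = ‖residual γ φ z m zs‖ ^ 2 +
      reg m * ∑ i ∈ Finset.range m, weight γ z m zs i ^ 2 := by
  have h1 : postVar γ z m zs = inner ℝ (residual γ φ z m zs) (φ zs) := by
    rw [postVar_eq_sub_sum, residual, inner_sub_left, sum_inner, hφ]
    simp only [real_inner_smul_left, hφ, mul_comm]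
  have h2 : φ zs = residual γ φ z m zs + ∑ i ∈ Finset.range m, weight γ z m zs i • φ (z i) := by
    rw [residual, sub_add_cancel]
  rw [h1, h2, inner_add_right, real_inner_self_eq_norm_sq, inner_sum, Finset.mul_sum]
  congr 1
  refine Finset.sum_congr rfl fun i hi => ?_
  rw [real_inner_smul_right, inner_residual_sample hφ (Finset.mem_range.mp hi)]
  ring

theorem postVar_le (hφ : ∀ x y, inner ℝ (φ x) (φ y) = rbf γ x y) (b : ℕ → ℝ) :
    postVar γ z m zs ≤ ‖φ zs - ∑ i ∈ Finset.range m, b i • φ (z i)‖ ^ 2 +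
      reg m * ∑ i ∈ Finset.range m, b i ^ 2 := by
  have h : φ zs - ∑ i ∈ Finset.range m, b i • φ (z i) = residual γ φ z m zs +
      ∑ i ∈ Finset.range m, (weight γ z m zs i - b i) • φ (z i) := by
    simp only [residual, sub_smul, Finset.sum_sub_distrib]
    abel
  have h2 : inner ℝ (residual γ φ z m zs)
        (∑ i ∈ Finset.range m, (weight γ z m zs i - b i) • φ (z i)) =
      reg m * ∑ i ∈ Finset.range m, (weight γ z m zs i - b i) * weight γ z m zs i := by
    rw [inner_sum, Finset.mul_sum]
    refine Finset.sum_congr rfl fun i hi => ?_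
    rw [real_inner_smul_right, inner_residual_sample hφ (Finset.mem_range.mp hi)]
    ring
  rw [h, postVar_eq hφ, norm_add_sq_real, h2]
  have h3 : 0 ≤ reg m * ∑ i ∈ Finset.range m, (weight γ z m zs i - b i) ^ 2 :=
    mul_nonneg (reg_nonneg m) (Finset.sum_nonneg fun _ _ => sq_nonneg _)
  have h4 : ∑ i ∈ Finset.range m, (weight γ z m zs i - b i) ^ 2 =
      2 * ∑ i ∈ Finset.range m, (weight γ z m zs i - b i) * weight γ z m zs i
        - ∑ i ∈ Finset.range m, weight γ z m zs i ^ 2 + ∑ i ∈ Finset.range m, b i ^ 2 := by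
    rw [Finset.mul_sum, ← Finset.sum_sub_distrib, ← Finset.sum_add_distrib]
    exact Finset.sum_congr rfl fun i _ => by ring
  rw [h4] at h3
  nlinarith [sq_nonneg ‖∑ i ∈ Finset.range m, (weight γ z m zs i - b i) • φ (z i)‖]

theorem postVar_nonneg (hγ : 0 < γ) : 0 ≤ postVar γ z m zs := by
  obtain ⟨φ, hφ⟩ := exists_featureMap d p hγ
  rw [postVar_eq hφ]
  exact add_nonneg (sq_nonneg _)
    (mul_nonneg (reg_nonneg m) (Finset.sum_nonneg fun _ _ => sq_nonneg _))

/-- More data and, at the same time, a smaller regularization parameter do not increase the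
predictive variance. -/
theorem postVar_antitone (hγ : 0 < γ) : Antitone fun m => postVar γ z m zs := by
  intro m n hmn
  obtain ⟨φ, hφ⟩ := exists_featureMap d p hγ
  change postVar γ z n zs ≤ postVar γ z m zs
  have hsub : Finset.range m ⊆ Finset.range n := Finset.range_subset_range.mpr hmn
  have hw : ∀ i ∉ Finset.range m, weight γ z m zs i = 0 := fun i hi => by
    rw [weight, dif_neg (by simpa using hi)]
  have h1 : ∑ i ∈ Finset.range m, weight γ z m zs i • φ (z i) =
      ∑ i ∈ Finset.range n, weight γ z m zs i • φ (z i) :=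
    Finset.sum_subset hsub fun i _ hi => by rw [hw i hi, zero_smul]
  have h2 : ∑ i ∈ Finset.range m, weight γ z m zs i ^ 2 =
      ∑ i ∈ Finset.range n, weight γ z m zs i ^ 2 :=
    Finset.sum_subset hsub fun i _ hi => by rw [hw i hi]; simp
  refine (postVar_le hφ (weight γ z m zs)).trans ?_
  rw [postVar_eq hφ, residual, h1, ← h2]
  refine add_le_add_right ?_ _
  rcases Nat.eq_zero_or_pos m with rfl | hm
  · simp
  · exact mul_le_mul_of_nonneg_right (reg_anti hm hmn) (Finset.sum_nonneg fun _ _ => sq_nonneg _)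

theorem visits_mono {m n : ℕ} (h : m ≤ n) : visits z m x ≤ visits z n x := by
  classical
  exact Finset.card_le_card (Finset.filter_subset_filter _ (Finset.range_subset_range.mpr h))

theorem visits_lt_visits {m n : ℕ} (h : m < n) : visits z m (z m) < visits z n (z m) := by
  classical
  refine Finset.card_lt_card (Finset.ssubset_iff_of_subset ?_ |>.mpr ⟨m, ?_, ?_⟩)
  · exact Finset.filter_subset_filter _ (Finset.range_subset_range.mpr h.le)
  · simpa using h
  · simp

theorem visits_zero : visits z 0 x = 0 := by
  simp [visits]

open scoped Classical in
theorem sum_ite_eq_visits (a : ℝ) :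
    ∑ i ∈ Finset.range m, (if z i = x then a else 0) = visits z m x * a := by
  rw [← Finset.sum_filter, Finset.sum_const, nsmul_eq_mul]
  rfl

/-- The variance at a point is at most what repeated observations of that point alone achieve. -/
theorem postVar_le_of_visits (hγ : 0 < γ) :
    postVar γ z m zs ≤ 1 / (1 + visits z m zs * (m : ℝ) ^ 2) := by
  classical
  obtain ⟨φ, hφ⟩ := exists_featureMap d p hγ
  rcases Nat.eq_zero_or_pos m with rfl | hm
  · simp [postVar_eq_sub_sum, rbf_self]
  set j : ℝ := (visits z m zs : ℝ)
  have hj : 0 ≤ j := Nat.cast_nonneg _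
  have hr := reg_pos hm
  refine (postVar_le hφ fun i => if z i = zs then 1 / (j + reg m) else 0).trans (le_of_eq ?_)
  have h1 : ∑ i ∈ Finset.range m, (if z i = zs then 1 / (j + reg m) else 0) • φ (z i) =
      (j * (1 / (j + reg m))) • φ zs := by
    rw [← sum_ite_eq_visits, Finset.sum_smul]
    refine Finset.sum_congr rfl fun i _ => ?_
    split_ifs with h
    · rw [h]
    · simp
  have h2 : ∑ i ∈ Finset.range m, (if z i = zs then 1 / (j + reg m) else 0) ^ 2 =
      j * (1 / (j + reg m)) ^ 2 := by
    rw [← sum_ite_eq_visits]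
    refine Finset.sum_congr rfl fun i _ => ?_
    split_ifs <;> simp
  have h3 : φ zs - (j * (1 / (j + reg m))) • φ zs = (1 - j * (1 / (j + reg m))) • φ zs := by
    rw [sub_smul, one_smul]
  have h4 : ‖φ zs‖ ^ 2 = 1 := by rw [← real_inner_self_eq_norm_sq, hφ, rbf_self]
  rw [h1, h2, h3, norm_smul, mul_pow, h4, Real.norm_eq_abs, sq_abs]
  have h5 : (m : ℝ) ^ 2 = 1 / reg m := by rw [eq_div_iff hr.ne', sq_mul_reg hm]
  rw [h5]
  have : j + reg m ≠ 0 := by positivity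
  have : 1 + j * (1 / reg m) ≠ 0 := by positivity
  have : reg m + j ≠ 0 := by positivity
  field_simp
  ring

/-- The variance at a point cannot be much smaller than what repeated observations of that point
alone achieve: `g` is an element of the Hilbert space that is `1` at `zs` and does not see the
other points. -/
theorem one_le_mul_postVar (hφ : ∀ x y, inner ℝ (φ x) (φ y) = rbf γ x y) {g : H}
    (hg : inner ℝ g (φ zs) = 1) (hg0 : ∀ i < m, z i ≠ zs → inner ℝ g (φ (z i)) = 0) :
    1 ≤ (‖g‖ ^ 2 + visits z m zs * (m : ℝ) ^ 2) * postVar γ z m zs := by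
  classical
  set a := ‖g‖
  set b := ‖residual γ φ z m zs‖
  set F := (Finset.range m).filter fun i => z i = zs
  set S := ∑ i ∈ F, weight γ z m zs i
  set W := ∑ i ∈ Finset.range m, weight γ z m zs i ^ 2
  have h1 : 1 = inner ℝ g (residual γ φ z m zs) + S := by
    rw [residual, inner_sub_right, hg, inner_sum]
    have : ∑ i ∈ Finset.range m, inner ℝ g (weight γ z m zs i • φ (z i)) = S := by
      simp only [S, F, Finset.sum_filter]
      refine Finset.sum_congr rfl fun i hi => ?_
      rw [real_inner_smul_right]
      split_ifs with h
      · rw [h, hg, mul_one]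
      · rw [hg0 i (Finset.mem_range.mp hi) h, mul_zero]
    rw [this]
    ring
  have h2 : (1 : ℝ) ≤ a * b + |S| := by
    have := real_inner_le_norm g (residual γ φ z m zs)
    have := le_abs_self S
    linarith
  have hW : 0 ≤ W := Finset.sum_nonneg fun _ _ => sq_nonneg _
  have h3 : S ^ 2 ≤ visits z m zs * W := by
    refine sq_sum_le_card_mul_sum_sq.trans ?_
    refine mul_le_mul_of_nonneg_left ?_ (Nat.cast_nonneg _)
    exact Finset.sum_le_sum_of_subset_of_nonneg (Finset.filter_subset _ _)
      fun _ _ _ => sq_nonneg _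
  set J : ℝ := visits z m zs * (m : ℝ) ^ 2
  have hJ : 0 ≤ J := by positivity
  set V : ℝ := reg m * W
  have hV : 0 ≤ V := mul_nonneg (reg_nonneg m) hW
  have h4 : S ^ 2 ≤ J * V := by
    rcases Nat.eq_zero_or_pos m with rfl | hm
    · simpa [visits, J] using h3
    · have : J * V = visits z m zs * W * ((m : ℝ) ^ 2 * reg m) := by simp only [J, V]; ring
      rwa [this, sq_mul_reg hm, mul_one]
  have ha : 0 ≤ a := norm_nonneg _
  have hb : 0 ≤ b := norm_nonneg _
  have h5 : 2 * (a * b) * |S| ≤ a ^ 2 * V + J * b ^ 2 := by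
    refine abs_le_of_sq_le_sq' ?_ (by positivity) |>.2
    have : (2 * (a * b) * |S|) ^ 2 = 4 * (a * b) ^ 2 * S ^ 2 := by
      rw [mul_pow, sq_abs]; ring
    rw [this]
    nlinarith [mul_le_mul_of_nonneg_left h4 (by positivity : 0 ≤ 4 * (a * b) ^ 2),
      sq_nonneg (a ^ 2 * V - J * b ^ 2)]
  rw [postVar_eq hφ]
  have h6 : (1 : ℝ) ≤ (a * b + |S|) ^ 2 := one_le_pow₀ h2
  have h7 : (a * b + |S|) ^ 2 = (a * b) ^ 2 + 2 * (a * b) * |S| + S ^ 2 := by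
    rw [add_sq, sq_abs]
  change (1 : ℝ) ≤ (a ^ 2 + J) * (b ^ 2 + V)
  nlinarith

/-- If both `x` and `zs` have been visited at least `J` times, their posterior covariance is at most
`reg m / J`. -/
theorem abs_inner_residual_le (hγ : 0 < γ) (hφ : ∀ x y, inner ℝ (φ x) (φ y) = rbf γ x y)
    (hm : 0 < m) {J : ℝ} (hJ : 0 < J) (hx : J ≤ visits z m x) (hzs : J ≤ visits z m zs) :
    (m : ℝ) ^ 2 * |inner ℝ (residual γ φ z m zs) (φ x)| ≤ 1 / J := by
  classical
  set ρ : ℝ := inner ℝ (residual γ φ z m zs) (φ x)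
  set M : ℝ := (m : ℝ) ^ 2
  have hM : 0 < M := by positivity
  have hMr : M * reg m = 1 := sq_mul_reg hm
  have h1 : visits z m x * (M * ρ) ^ 2 ≤ ∑ i ∈ Finset.range m, weight γ z m zs i ^ 2 := by
    rw [← sum_ite_eq_visits]
    refine Finset.sum_le_sum fun i hi => ?_
    split_ifs with h
    · have := inner_residual_sample (zs := zs) (z := z) hφ (Finset.mem_range.mp hi)
      rw [h] at this
      change ρ = _ at this
      rw [this, ← mul_assoc, hMr, one_mul]
    · exact sq_nonneg _
  have h2 : reg m * ∑ i ∈ Finset.range m, weight γ z m zs i ^ 2 ≤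
      1 / (1 + visits z m zs * M) := by
    refine le_trans ?_ (postVar_le_of_visits hγ)
    rw [postVar_eq hφ]
    exact le_add_of_nonneg_left (sq_nonneg _)
  have h3 : 1 / (1 + visits z m zs * M) ≤ 1 / (J * M) := by
    gcongr
    nlinarith
  have h4 : J * (M * ρ) ^ 2 ≤ 1 / J := by
    calc J * (M * ρ) ^ 2 ≤ visits z m x * (M * ρ) ^ 2 := by gcongr
      _ ≤ M * (reg m * ∑ i ∈ Finset.range m, weight γ z m zs i ^ 2) := by
        rw [← mul_assoc, hMr, one_mul]; exact h1
      _ ≤ M * (1 / (J * M)) := mul_le_mul_of_nonneg_left (h2.trans h3) hM.le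
      _ = 1 / J := by field_simp
  have h5 : (M * |ρ|) ^ 2 ≤ (1 / J) ^ 2 := by
    have : (M * |ρ|) ^ 2 = (1 / J) * (J * (M * ρ) ^ 2) := by
      rw [mul_pow, sq_abs]; field_simp
    rw [this, sq (1 / J)]
    exact mul_le_mul_of_nonneg_left h4 (by positivity)
  exact abs_le_of_sq_le_sq' h5 (by positivity) |>.2

end Variance

/-! ### Decay of the predictive variance -/

section Decay

variable {d p : ℕ} {γ : ℝ} {N : ℕ}

theorem idx_lt_idx {t n τ : ℕ} (ht : 1 ≤ t) (hn : n < N) (h : t < τ) :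
    idx N t n < idx N τ 0 := by
  obtain ⟨t, rfl⟩ := Nat.exists_eq_add_of_le' ht
  obtain ⟨k, rfl⟩ := Nat.exists_eq_add_of_lt h
  simp only [idx, Nat.add_sub_cancel]
  calc t * N + n < t * N + N := by omega
    _ = (t + 1) * N := by ring
    _ ≤ (t + 1 + k) * N := Nat.mul_le_mul_right _ (by omega)

theorem IsUCBRun.sample_mem {X : Finset (Vec d)} {U : Finset (Vec p)}
    {p0 : StateAction d p → Vec d} {β : ℕ → ℕ → ℝ} {z : ℕ → StateAction d p} {y : ℕ → Vec d}
    (h : IsUCBRun X U N γ p0 β z y) (hN : 1 ≤ N) (i : ℕ) : z i ∈ X ×ˢ U := by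
  have hi : idx N (i / N + 1) (i % N) = i := by
    simp only [idx, Nat.add_sub_cancel]
    exact Nat.div_add_mod' i N
  have hlt : i % N < N := Nat.mod_lt _ hN
  have h1 := h.state_mem (i / N + 1) (i % N) (Nat.le_add_left 1 _) hlt
  obtain ⟨u, hu, hu0⟩ := h.action_eq (i / N + 1) (i % N) (Nat.le_add_left 1 _) hlt
  rw [hi] at h1 hu0
  exact Finset.mem_product.mpr ⟨h1, hu0 ▸ hu.1 0 hN⟩

variable {Z : Finset (StateAction d p)} {z : ℕ → StateAction d p}

theorem AboveAverage.exists_sum_le (hav : AboveAverage Z N γ z) (hZ : Z.Nonempty) {τ : ℕ}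
    (hτ : 1 ≤ τ) : ∃ n < N, ∑ x ∈ Z, postVar γ z (idx N τ n) x ≤
      Z.card * postVar γ z (idx N τ n) (z (idx N τ n)) := by
  obtain ⟨n, hn, h⟩ := hav τ hτ
  refine ⟨n, hn, ?_⟩
  have hc : (0 : ℝ) < Z.card := by exact_mod_cast hZ.card_pos
  rw [one_div, inv_mul_le_iff₀ hc] at h
  exact h

/-- A revisited point has a variance of at most `1 / (1 + m ^ 2)`; if it is above the average, then
all points of `Z` have a small variance. -/
theorem postVar_le_of_revisit (hγ : 0 < γ) {m n : ℕ} {x : StateAction d p} (hx : x ∈ Z)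
    (hmn : m ≤ n) (hvis : 1 ≤ visits z m (z m))
    (havg : ∑ x ∈ Z, postVar γ z m x ≤ Z.card * postVar γ z m (z m)) :
    postVar γ z n x ≤ Z.card / (1 + (m : ℝ) ^ 2) := by
  have h1 : postVar γ z m x ≤ ∑ x ∈ Z, postVar γ z m x :=
    Finset.single_le_sum (f := fun x => postVar γ z m x) (fun _ _ => postVar_nonneg hγ) hx
  have h2 : postVar γ z m (z m) ≤ 1 / (1 + (m : ℝ) ^ 2) := by
    refine (postVar_le_of_visits hγ).trans ?_
    have : (1 : ℝ) ≤ visits z m (z m) := by exact_mod_cast hvis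
    gcongr
    nlinarith [sq_nonneg (m : ℝ)]
  calc postVar γ z n x ≤ postVar γ z m x := postVar_antitone hγ hmn
    _ ≤ Z.card * postVar γ z m (z m) := h1.trans havg
    _ ≤ Z.card * (1 / (1 + (m : ℝ) ^ 2)) := by gcongr
    _ = _ := by ring

/-- After more than `Z.card` episodes, either all points have been visited, or one of the
above-average points of the last `Z.card` episodes had been visited before. -/
theorem predVar_le_or (hγ : 0 < γ) (hZ : Z.Nonempty) (hz : ∀ i, z i ∈ Z)
    (hav : AboveAverage Z N γ z) {τ : ℕ} (hτ : Z.card < τ) {x : StateAction d p} (hx : x ∈ Z) :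
    predVar N γ z τ 0 x ≤ 1 / (1 + (((τ : ℝ) - 1) * N) ^ 2) ∨
      2 ≤ Z.card ∧ predVar N γ z τ 0 x ≤ Z.card / (1 + (((τ : ℝ) - Z.card) * N) ^ 2) := by
  classical
  have hex : ∀ t, ∃ n, 1 ≤ t → n < N ∧ ∑ x ∈ Z, postVar γ z (idx N t n) x ≤
      Z.card * postVar γ z (idx N t n) (z (idx N t n)) := by
    intro t
    by_cases ht : 1 ≤ t
    · obtain ⟨n, h⟩ := hav.exists_sum_le hZ ht
      exact ⟨n, fun _ => h⟩
    · exact ⟨0, fun h => absurd h ht⟩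
  choose n hn using hex
  have hcard := hZ.card_pos
  by_cases hall : ∀ x ∈ Z, ∃ t, 1 ≤ t ∧ t < τ ∧ z (idx N t (n t)) = x
  · left
    obtain ⟨t, ht, htτ, rfl⟩ := hall x hx
    have h1 := visits_lt_visits (z := z) (idx_lt_idx ht (hn t ht).1 htτ)
    have h2 : (1 : ℝ) ≤ visits z (idx N τ 0) (z (idx N t (n t))) := by
      exact_mod_cast (Nat.zero_le _).trans_lt h1
    refine (postVar_le_of_visits hγ).trans ?_
    have h3 : ((idx N τ 0 : ℕ) : ℝ) = ((τ : ℝ) - 1) * N := by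
      simp [idx, Nat.cast_sub (show 1 ≤ τ by omega)]
    rw [h3]
    gcongr
    nlinarith [sq_nonneg (((τ : ℝ) - 1) * N)]
  · right
    push Not at hall
    obtain ⟨x₀, hx₀, hne⟩ := hall
    have hmaps : ∀ t ∈ Finset.Ico (τ - Z.card) τ, z (idx N t (n t)) ∈ Z.erase x₀ := by
      intro t ht
      rw [Finset.mem_Ico] at ht
      exact Finset.mem_erase.mpr ⟨hne t (by omega) ht.2, hz _⟩
    have hlt : (Z.erase x₀).card < (Finset.Ico (τ - Z.card) τ).card := by
      rw [Finset.card_erase_of_mem hx₀, Nat.card_Ico]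
      omega
    have h2 : 2 ≤ Z.card := by
      have : 0 < (Z.erase x₀).card :=
        Finset.card_pos.mpr ⟨_, hmaps (τ - 1) (Finset.mem_Ico.mpr ⟨by omega, by omega⟩)⟩
      rw [Finset.card_erase_of_mem hx₀] at this
      omega
    have hkey : ∃ s t, τ - Z.card ≤ s ∧ s < t ∧ t < τ ∧
        z (idx N s (n s)) = z (idx N t (n t)) := by
      obtain ⟨s, hs, t, ht, hst, heq⟩ :=
        Finset.exists_ne_map_eq_of_card_lt_of_maps_to hlt hmaps
      rw [Finset.mem_Ico] at hs ht
      rcases lt_or_gt_of_ne hst with h | h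
      · exact ⟨s, t, hs.1, h, ht.2, heq⟩
      · exact ⟨t, s, ht.1, h, hs.2, heq.symm⟩
    obtain ⟨s, t, hs, hst, htτ, heq⟩ := hkey
    refine ⟨h2, ?_⟩
    have hs1 : 1 ≤ s := by omega
    have ht1 : 1 ≤ t := by omega
    have hlt1 : idx N s (n s) < idx N t (n t) :=
      (idx_lt_idx hs1 (hn s hs1).1 hst).trans_le (by simp [idx])
    have hvis : 1 ≤ visits z (idx N t (n t)) (z (idx N t (n t))) := by
      have := visits_lt_visits (z := z) hlt1
      rw [heq] at this
      omega
    refine (postVar_le_of_revisit hγ hx (idx_lt_idx ht1 (hn t ht1).1 htτ).le hvis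
      (hn t ht1).2).trans ?_
    have h3 : 0 ≤ (τ : ℝ) - Z.card := by
      have : (Z.card : ℝ) ≤ τ := by exact_mod_cast hτ.le
      linarith
    have h4 : ((τ : ℝ) - Z.card) * N ≤ ((idx N t (n t) : ℕ) : ℝ) := by
      have h5 : (τ - Z.card) * N ≤ idx N t (n t) :=
        (Nat.mul_le_mul_right N (show τ - Z.card ≤ t - 1 by omega)).trans (Nat.le_add_right _ _)
      have : ((τ : ℝ) - Z.card) * N = (((τ - Z.card) * N : ℕ) : ℝ) := by
        rw [Nat.cast_mul, Nat.cast_sub hτ.le]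
      rw [this]
      exact_mod_cast h5
    gcongr

theorem predVar_le_of_episodeBound_le (hN : 1 ≤ N) (hγ : 0 < γ) (hZ : Z.Nonempty)
    (hz : ∀ i, z i ∈ Z) (hav : AboveAverage Z N γ z) {ε : ℝ} (hε : 0 < ε) {τ : ℕ}
    (h3 : 3 ≤ τ ∨ 3 ≤ Z.card) (hτ : episodeBound Z.card N ε ≤ τ) {x : StateAction d p}
    (hx : x ∈ Z) : predVar N γ z τ 0 x ≤ ε := by
  rcases le_or_gt 1 ε with h1 | h1
  · refine le_trans ?_ h1
    refine (postVar_le_of_visits hγ).trans (div_le_one_of_le₀ ?_ (by positivity))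
    exact le_add_of_nonneg_right (by positivity)
  have hc : (1 : ℝ) ≤ Z.card := by exact_mod_cast hZ.card_pos
  have hD : (1 : ℝ) ≤ (N : ℝ) ^ 2 := one_le_pow₀ (by exact_mod_cast hN)
  have hlogle : Real.log Z.card ≤ Real.log (Z.card / ε) := by
    refine Real.log_le_log (by linarith) ?_
    rw [le_div_iff₀ hε]
    nlinarith
  have hlog0 : 0 ≤ Real.log Z.card := Real.log_nonneg hc
  -- `ε < 1` enters here: it makes `τ` larger than `Z.card * log Z.card`.
  have hbound : (Z.card : ℝ) * (Z.card - ε) ≤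
      (τ - Z.card * Real.log Z.card) * ((N : ℝ) ^ 2 * ε) := by
    rw [← div_le_iff₀ (by positivity)]
    have : (Z.card : ℝ) * Real.log Z.card ≤ Z.card * Real.log (Z.card / ε) := by gcongr
    rw [episodeBound] at hτ
    linarith
  have hlt : (Z.card : ℝ) * Real.log Z.card < τ := by
    by_contra hcon
    have h4 : (τ - Z.card * Real.log Z.card) * ((N : ℝ) ^ 2 * ε) ≤ 0 :=
      mul_nonpos_of_nonpos_of_nonneg (by linarith) (by positivity)
    have h5 : 0 < (Z.card : ℝ) * (Z.card - ε) := mul_pos (by linarith) (by linarith)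
    linarith
  have hcτ : Z.card < τ ∧ 3 ≤ τ := by
    by_cases h : 3 ≤ Z.card
    · have h4 : (1 : ℝ) ≤ Real.log Z.card := by
        rw [Real.le_log_iff_exp_le (by linarith)]
        have : (3 : ℝ) ≤ Z.card := by exact_mod_cast h
        linarith [Real.exp_one_lt_d9]
      have h5 : (Z.card : ℝ) < τ := by nlinarith
      have h6 : Z.card < τ := by exact_mod_cast h5
      omega
    · omega
  have hτ3 : (3 : ℝ) ≤ τ := by exact_mod_cast hcτ.2
  rcases predVar_le_or hγ hZ hz hav hcτ.1 hx with h | ⟨h2, h⟩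
  · refine h.trans ?_
    rw [div_le_iff₀ (by positivity), mul_pow]
    set c : ℝ := (Z.card : ℝ)
    have hcc : c ≤ c ^ 2 := by nlinarith
    have h4 : (τ : ℝ) ≤ ((τ : ℝ) - 1) ^ 2 := by nlinarith
    have h5 : c ^ 2 ≤ ε * (c + τ * (N : ℝ) ^ 2) := by
      have : 0 ≤ c * Real.log c * ((N : ℝ) ^ 2 * ε) := by positivity
      nlinarith
    have h6 : c + τ * (N : ℝ) ^ 2 ≤ c ^ 2 * (1 + ((τ : ℝ) - 1) ^ 2 * (N : ℝ) ^ 2) := by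
      have h7 : τ * (N : ℝ) ^ 2 ≤ ((τ : ℝ) - 1) ^ 2 * (N : ℝ) ^ 2 := by gcongr
      have h8 : (1 : ℝ) ≤ c ^ 2 := one_le_pow₀ hc
      nlinarith [mul_nonneg (sub_nonneg.mpr h8)
        (by positivity : 0 ≤ ((τ : ℝ) - 1) ^ 2 * (N : ℝ) ^ 2)]
    have h7 : c ^ 2 * 1 ≤ c ^ 2 * (ε * (1 + ((τ : ℝ) - 1) ^ 2 * (N : ℝ) ^ 2)) := by
      nlinarith [mul_le_mul_of_nonneg_left h6 hε.le]
    exact le_of_mul_le_mul_left h7 (by positivity)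
  · refine h.trans ?_
    rw [div_le_iff₀ (by positivity), mul_pow]
    have hd : (Z.card : ℝ) + 1 ≤ τ := by exact_mod_cast hcτ.1
    have hc2 : (2 : ℝ) ≤ Z.card := by exact_mod_cast h2
    set c : ℝ := (Z.card : ℝ)
    set e : ℝ := (τ : ℝ) - c with he
    have he1 : 1 ≤ e := by linarith
    have hlog1 : 1 ≤ c * Real.log c := by
      have : Real.log 2 ≤ Real.log c := Real.log_le_log (by norm_num) hc2
      nlinarith [Real.log_two_gt_d9]
    have h4 : (τ : ℝ) - c * Real.log c ≤ c * e ^ 2 := by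
      nlinarith [mul_nonneg (sub_nonneg.mpr he1) (by nlinarith : 0 ≤ c * (e + 1) - 1)]
    have h5 : c * (c - ε) ≤ c * e ^ 2 * ((N : ℝ) ^ 2 * ε) :=
      hbound.trans (by gcongr)
    have h6 : c * c ≤ c * (ε * (1 + e ^ 2 * (N : ℝ) ^ 2)) := by nlinarith
    exact le_of_mul_le_mul_left h6 (by linarith)

theorem tendsto_sup'_predVar (hN : 1 ≤ N) (hγ : 0 < γ) (hZ : Z.Nonempty)
    (hz : ∀ i, z i ∈ Z) (hav : AboveAverage Z N γ z) :
    Tendsto (fun τ => Z.sup' hZ (predVar N γ z τ 0)) atTop (𝓝 0) := by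
  refine tendsto_order.mpr ⟨fun a ha => Eventually.of_forall fun τ => ?_, fun a ha => ?_⟩
  · obtain ⟨x, hx⟩ := hZ
    exact ha.trans_le ((postVar_nonneg hγ).trans (Finset.le_sup' (predVar N γ z τ 0) hx))
  · filter_upwards [eventually_ge_atTop 3,
      eventually_ge_atTop ⌈episodeBound Z.card N (a / 2)⌉₊] with τ h3 hτ
    refine lt_of_le_of_lt (Finset.sup'_le _ _ fun x hx => ?_) (half_lt_self ha)
    exact predVar_le_of_episodeBound_le hN hγ hZ hz hav (half_pos ha) (Or.inl h3)
      (Nat.ceil_le.mp hτ) hx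

end Decay

/-! ### A law of large numbers for predictably weighted noise -/

section LawOfLargeNumbers

/-- Kronecker's lemma for the weights `i + 1`. -/
theorem tendsto_average_zero_of_tendsto_sum_div {u : ℕ → ℝ} {L : ℝ}
    (h : Tendsto (fun n => ∑ i ∈ Finset.range n, u i / (i + 1)) atTop (𝓝 L)) :
    Tendsto (fun n : ℕ => (n : ℝ)⁻¹ * ∑ i ∈ Finset.range n, u i) atTop (𝓝 0) := by
  set S : ℕ → ℝ := fun n => ∑ i ∈ Finset.range n, u i / (i + 1)
  have hab : ∀ n : ℕ, ∑ i ∈ Finset.range n, u i = n * S n - ∑ i ∈ Finset.range n, S i := by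
    intro n
    induction n with
    | zero => simp
    | succ n ih =>
      have hS : S (n + 1) = S n + u n / (n + 1) := Finset.sum_range_succ _ _
      have : (n : ℝ) + 1 ≠ 0 := by positivity
      rw [Finset.sum_range_succ, ih, Finset.sum_range_succ _ n, hS]
      push_cast
      field_simp
      ring
  have h2 := h.sub h.cesaro
  rw [sub_self] at h2
  refine h2.congr' ?_
  filter_upwards [eventually_ge_atTop 1] with n hn
  have : (n : ℝ) ≠ 0 := by positivity
  rw [hab]
  field_simp

/-- The moments of the coordinates of isotropic Gaussian noise. -/
theorem memLp_and_moments_of_map_eq {Ω : Type*} [MeasurableSpace Ω] {P : Measure Ω}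
    {d : ℕ} {W : Ω → Vec d} (hW : Measurable W) {v : ℝ≥0}
    (hlaw : P.map W = multivariateGaussian 0 ((v : ℝ) • (1 : Matrix (Fin d) (Fin d) ℝ)))
    (l : Fin d) :
    MemLp (fun ω => W ω l) 2 P ∧ ∫ ω, W ω l ∂P = 0 ∧ ∫ ω, W ω l ^ 2 ∂P = v := by
  have hpsd : ((v : ℝ) • (1 : Matrix (Fin d) (Fin d) ℝ)).PosSemidef :=
    Matrix.PosSemidef.one.smul v.coe_nonneg
  have hmp : MeasurePreserving (fun ω => W ω l) P (gaussianReal 0 v) := by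
    have h := (measurePreserving_eval_multivariateGaussian (μ := (0 : Vec d)) hpsd (i := l)).comp
      ⟨hW, hlaw⟩
    simp only [PiLp.zero_apply, Matrix.smul_apply, Matrix.one_apply_eq, smul_eq_mul, mul_one,
      Real.toNNReal_coe] at h
    exact h
  have hmem : MemLp (fun ω => W ω l) 2 P :=
    (memLp_id_gaussianReal' 2 (by simp)).comp_measurePreserving hmp
  have hmean : ∫ ω, W ω l ∂P = 0 := by
    have h := integral_map (μ := P) hmp.measurable.aemeasurable
      (f := fun x : ℝ => x) (by fun_prop)
    rw [hmp.map_eq, integral_id_gaussianReal] at h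
    exact h.symm
  refine ⟨hmem, hmean, ?_⟩
  have h := variance_map (μ := P) (X := fun x : ℝ => x) (by fun_prop) hmp.measurable.aemeasurable
  rw [hmp.map_eq, variance_fun_id_gaussianReal] at h
  rw [h, variance_of_integral_eq_zero]
  · rfl
  · exact hmp.measurable.aemeasurable
  · exact hmean

variable {Ω : Type*} [mΩ : MeasurableSpace Ω] {P : Measure Ω} [IsProbabilityMeasure P]
  {ℱ : Filtration ℕ mΩ}

/-- Centred noise that is independent of the past, has bounded variances and is multiplied by
bounded predictable weights averages out: the series `∑ a i * ξ i / (i + 1)` is a martingale that is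
bounded in `L²`, so it converges. -/
theorem ae_tendsto_average_zero {a ξ : ℕ → Ω → ℝ} {C : ℝ}
    (ha : ∀ j, StronglyMeasurable[ℱ j] (a j)) (ha1 : ∀ j ω, |a j ω| ≤ 1)
    (hξ : ∀ j, StronglyMeasurable[ℱ (j + 1)] (ξ j))
    (hind : ∀ j, Indep (MeasurableSpace.comap (ξ j) inferInstance) (ℱ j) P)
    (hL2 : ∀ j, MemLp (ξ j) 2 P) (hmean : ∀ j, ∫ ω, ξ j ω ∂P = 0)
    (hvar : ∀ j, ∫ ω, ξ j ω ^ 2 ∂P ≤ C) :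
    ∀ᵐ ω ∂P, Tendsto (fun n : ℕ => (n : ℝ)⁻¹ * ∑ i ∈ Finset.range n, a i ω * ξ i ω)
      atTop (𝓝 0) := by
  let b : ℕ → Ω → ℝ := fun j ω => a j ω / (j + 1)
  let D : ℕ → Ω → ℝ := fun j ω => b j ω * ξ j ω
  let S : ℕ → Ω → ℝ := fun n ω => ∑ i ∈ Finset.range n, D i ω
  have hC : 0 ≤ C := (integral_nonneg fun _ => sq_nonneg _).trans (hvar 0)
  have hb : ∀ j, StronglyMeasurable[ℱ j] (b j) := fun j => (ha j).div stronglyMeasurable_const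
  have hb1 : ∀ j ω, |b j ω| ≤ 1 / ((j : ℝ) + 1) := fun j ω => by
    simp only [b, abs_div]
    rw [abs_of_pos (by positivity : (0 : ℝ) < (j : ℝ) + 1)]
    gcongr
    exact ha1 j ω
  have hD : ∀ j, StronglyMeasurable[ℱ (j + 1)] (D j) := fun j =>
    ((hb j).mono (ℱ.mono (Nat.le_succ j))).mul (hξ j)
  have hDL2 : ∀ j, MemLp (D j) 2 P := fun j => by
    refine MemLp.of_le_mul (c := 1 / ((j : ℝ) + 1)) (hL2 j)
      ((hD j).mono (ℱ.le _)).aestronglyMeasurable (ae_of_all _ fun ω => ?_)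
    simp only [D, norm_mul, Real.norm_eq_abs]
    exact mul_le_mul_of_nonneg_right (hb1 j ω) (abs_nonneg _)
  have hS : ∀ n, StronglyMeasurable[ℱ n] (S n) := fun n =>
    Finset.stronglyMeasurable_fun_sum _ fun i hi =>
      (hD i).mono (ℱ.mono (Finset.mem_range.mp hi))
  have hSL2 : ∀ n, MemLp (S n) 2 P := fun n => memLp_finsetSum _ fun i _ => hDL2 i
  have hmart : Martingale S ℱ P := by
    refine martingale_of_condExp_sub_eq_zero_nat hS
      (fun n => (hSL2 n).integrable one_le_two) fun n => ?_
    have h1 : S (n + 1) - S n = b n * ξ n := by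
      funext ω
      simp [S, D, Finset.sum_range_succ]
    have h2 : P[ξ n | ℱ n] =ᵐ[P] fun _ => ∫ ω, ξ n ω ∂P :=
      condExp_indep_eq ((hξ n).mono (ℱ.le _)).measurable.comap_le (ℱ.le n)
        (comap_measurable (ξ n)).stronglyMeasurable (hind n)
    rw [h1]
    filter_upwards [condExp_stronglyMeasurable_mul_of_bound (ℱ.le n) (hb n)
      ((hL2 n).integrable one_le_two) _ (ae_of_all _ (hb1 n)), h2] with ω h3 h4
    rw [h3, Pi.mul_apply, h4, hmean, mul_zero, Pi.zero_apply]
  have hcross : ∀ n, ∫ ω, S n ω * D n ω ∂P = 0 := by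
    intro n
    have h1 : IndepFun (fun ω => S n ω * b n ω) (ξ n) P := by
      rw [IndepFun_iff_Indep]
      exact indep_of_indep_of_le_left (hind n).symm
        (((hS n).mul (hb n)).measurable.comap_le)
    have h2 := h1.integral_fun_mul_eq_mul_integral
      (((hS n).mul (hb n)).mono (ℱ.le n)).aestronglyMeasurable (hL2 n).1
    rw [hmean, mul_zero] at h2
    simpa [D, mul_assoc] using h2
  have hDsq : ∀ n, ∫ ω, D n ω ^ 2 ∂P ≤ C * (1 / ((n : ℝ) + 1) ^ 2) := by
    intro n
    calc ∫ ω, D n ω ^ 2 ∂P ≤ ∫ ω, (1 / ((n : ℝ) + 1) ^ 2) * ξ n ω ^ 2 ∂P := by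
          refine integral_mono (hDL2 n).integrable_sq ((hL2 n).integrable_sq.const_mul _)
            fun ω => ?_
          simp only [D, mul_pow]
          refine mul_le_mul_of_nonneg_right ?_ (sq_nonneg _)
          have := pow_le_pow_left₀ (abs_nonneg _) (hb1 n ω) 2
          rwa [sq_abs, one_div_pow] at this
      _ = (1 / ((n : ℝ) + 1) ^ 2) * ∫ ω, ξ n ω ^ 2 ∂P := integral_const_mul _ _
      _ ≤ (1 / ((n : ℝ) + 1) ^ 2) * C := by
          gcongr
          exact hvar n
      _ = _ := mul_comm _ _
  have hsum : Summable fun i : ℕ => 1 / ((i : ℝ) + 1) ^ 2 := by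
    have := (summable_nat_add_iff 1).mpr (Real.summable_one_div_nat_pow.mpr one_lt_two)
    simpa using this
  set K : ℝ := C * ∑' i : ℕ, 1 / ((i : ℝ) + 1) ^ 2
  have hSsq : ∀ n, ∫ ω, S n ω ^ 2 ∂P ≤ K := by
    have h1 : ∀ n, ∫ ω, S n ω ^ 2 ∂P ≤ C * ∑ i ∈ Finset.range n, 1 / ((i : ℝ) + 1) ^ 2 := by
      intro n
      induction n with
      | zero => simp [S]
      | succ n ih =>
        have h2 : ∀ ω, S (n + 1) ω ^ 2 = S n ω ^ 2 + 2 * (S n ω * D n ω) + D n ω ^ 2 := by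
          intro ω
          have : S (n + 1) ω = S n ω + D n ω := Finset.sum_range_succ _ _
          rw [this]
          ring
        have hi1 := (hSL2 n).integrable_sq
        have hi2 := ((hSL2 n).integrable_mul (hDL2 n)).const_mul 2
        have hi3 := (hDL2 n).integrable_sq
        simp only [Pi.mul_apply] at hi2
        have hi12 : Integrable (fun ω => S n ω ^ 2 + 2 * (S n ω * D n ω)) P := hi1.add hi2
        have h3 : ∫ ω, S (n + 1) ω ^ 2 ∂P =
            ∫ ω, S n ω ^ 2 ∂P + 2 * ∫ ω, S n ω * D n ω ∂P + ∫ ω, D n ω ^ 2 ∂P := by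
          simp only [h2]
          rw [integral_add hi12 hi3, integral_add hi1 hi2, integral_const_mul]
        rw [h3, hcross, mul_zero, add_zero, Finset.sum_range_succ, mul_add]
        exact add_le_add ih (hDsq n)
    intro n
    exact (h1 n).trans (mul_le_mul_of_nonneg_left
      (hsum.sum_le_tsum _ fun i _ => by positivity) hC)
  have hbdd : ∀ n, eLpNorm (S n) 1 P ≤ ((1 + K).toNNReal : ℝ≥0) := by
    intro n
    have hint := (hSL2 n).integrable one_le_two
    rw [eLpNorm_one_eq_lintegral_enorm, ← ofReal_integral_norm_eq_lintegral_enorm hint]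
    refine ENNReal.ofReal_le_ofReal ?_
    calc ∫ ω, ‖S n ω‖ ∂P ≤ ∫ ω, (1 + S n ω ^ 2) ∂P := by
          refine integral_mono hint.norm ((integrable_const 1).add (hSL2 n).integrable_sq)
            fun ω => ?_
          simp only [Real.norm_eq_abs]
          nlinarith [sq_abs (S n ω), sq_nonneg (|S n ω| - 1), abs_nonneg (S n ω)]
      _ = 1 + ∫ ω, S n ω ^ 2 ∂P := by
          rw [integral_add (integrable_const 1) (hSL2 n).integrable_sq]
          simp
      _ ≤ 1 + K := by
          gcongr
          exact hSsq n
  filter_upwards [hmart.submartingale.ae_tendsto_limitProcess hbdd] with ω hω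
  refine tendsto_average_zero_of_tendsto_sum_div (hω.congr fun n => ?_)
  exact Finset.sum_congr rfl fun i _ => by simp only [D, b]; ring

/-- The noise summed over the visits of a point grows more slowly than the number of samples. -/
theorem ae_tendsto_noise_average {d p : ℕ} {z : ℕ → Ω → StateAction d p} {w : ℕ → Ω → Vec d}
    (hz : ∀ j, Measurable[ℱ j] (z j)) (hw : ∀ j, Measurable[ℱ (j + 1)] (w j))
    (hind : ∀ j, Indep (MeasurableSpace.comap (w j) inferInstance) (ℱ j) P)
    {v : ℕ → ℝ≥0} (hv : BddAbove (Set.range v))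
    (hlaw : ∀ j, P.map (w j) =
      multivariateGaussian 0 ((v j : ℝ) • (1 : Matrix (Fin d) (Fin d) ℝ)))
    (x : StateAction d p) (l : Fin d) :
    ∀ᵐ ω ∂P, Tendsto (fun n : ℕ => (n : ℝ)⁻¹ *
      ∑ i ∈ Finset.range n, ({x} : Set (StateAction d p)).indicator 1 (z i ω) * w i ω l)
      atTop (𝓝 0) := by
  obtain ⟨C, hC⟩ := hv
  have hw' : ∀ j, Measurable (w j) := fun j => (hw j).mono (ℱ.le _) le_rfl
  refine ae_tendsto_average_zero (ℱ := ℱ) (C := C)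
    (a := fun j ω => ({x} : Set (StateAction d p)).indicator 1 (z j ω))
    (ξ := fun j ω => w j ω l) (fun j => ?_) (fun j ω => ?_) (fun j => ?_) (fun j => ?_)
    (fun j => (memLp_and_moments_of_map_eq (hw' j) (hlaw j) l).1)
    (fun j => (memLp_and_moments_of_map_eq (hw' j) (hlaw j) l).2.1) (fun j => ?_)
  · exact ((measurable_one.indicator (measurableSet_singleton x)).comp (hz j)).stronglyMeasurable
  · by_cases h : z j ω ∈ ({x} : Set (StateAction d p)) <;> simp [h]
  · have h : Measurable fun y : Vec d => y l := by fun_prop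
    exact (h.comp (hw j)).stronglyMeasurable
  · have h : Measurable fun y : Vec d => y l := by fun_prop
    refine indep_of_indep_of_le_left (hind j) ?_
    exact (h.comp (comap_measurable (w j))).comap_le
  · rw [(memLp_and_moments_of_map_eq (hw' j) (hlaw j) l).2.2]
    exact_mod_cast hC ⟨j, rfl⟩

end LawOfLargeNumbers

/-! ### Consistency of the predictive mean -/

section Consistency

variable {d p : ℕ} {γ : ℝ} {N : ℕ} {Z : Finset (StateAction d p)} {z : ℕ → StateAction d p}

/-- All points are visited linearly often: the variance at a point with `j` visits is about
`reg m / j`, so a sampled point that is above average cannot have been visited much more often than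
any other point. -/
theorem exists_visits_ge (hγ : 0 < γ) (hZ : Z.Nonempty) (hz : ∀ i, z i ∈ Z)
    (hav : AboveAverage Z N γ z) :
    ∃ K : ℝ, 0 < K ∧ ∀ τ : ℕ, ∀ x ∈ Z, (τ : ℝ) ≤ K * (visits z (idx N (τ + 1) 0) x + 1) := by
  classical
  obtain ⟨φ, hφ⟩ := exists_featureMap d p hγ
  obtain ⟨g, hg⟩ := exists_dual hγ hφ Z
  set κ : ℝ := ∑ x ∈ Z, ‖g x‖ ^ 2
  have hκ : 0 ≤ κ := Finset.sum_nonneg fun _ _ => sq_nonneg _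
  set c : ℝ := (Z.card : ℝ)
  have hc : 1 ≤ c := Nat.one_le_cast.mpr hZ.card_pos
  refine ⟨c * (c * (1 + κ) + 1), by positivity, fun τ x hx => ?_⟩
  set J : ℝ := (visits z (idx N (τ + 1) 0) x : ℝ)
  have hJ : 0 ≤ J := Nat.cast_nonneg _
  have hex : ∀ t, ∃ n, 1 ≤ t → n < N ∧ ∑ x ∈ Z, postVar γ z (idx N t n) x ≤
      Z.card * postVar γ z (idx N t n) (z (idx N t n)) := by
    intro t
    by_cases ht : 1 ≤ t
    · obtain ⟨n, h⟩ := hav.exists_sum_le hZ ht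
      exact ⟨n, fun _ => h⟩
    · exact ⟨0, fun h => absurd h ht⟩
  choose n hn using hex
  set B : ℝ := c * (κ + J)
  have hB : 0 ≤ B := by positivity
  have hpick : ∀ t, 1 ≤ t → t < τ + 1 →
      (visits z (idx N t (n t)) (z (idx N t (n t))) : ℝ) ≤ B := by
    intro t ht htτ
    set m := idx N t (n t)
    rcases Nat.eq_zero_or_pos m with h0 | hm
    · rw [h0, visits_zero, Nat.cast_zero]
      exact hB
    have h1 : 1 ≤ (‖g x‖ ^ 2 + visits z m x * (m : ℝ) ^ 2) * postVar γ z m x := by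
      refine one_le_mul_postVar hφ ?_ fun i _ hne => ?_
      · rw [hg x hx x hx, if_pos rfl]
      · rw [hg x hx _ (hz i), if_neg (Ne.symm hne)]
    have h2 : ‖g x‖ ^ 2 ≤ κ :=
      Finset.single_le_sum (f := fun x => ‖g x‖ ^ 2) (fun _ _ => sq_nonneg _) hx
    have h3 : (visits z m x : ℝ) ≤ J :=
      Nat.cast_le.mpr (visits_mono (idx_lt_idx ht (hn t ht).1 htτ).le)
    have h4 : postVar γ z m x ≤ c * (1 / (1 + visits z m (z m) * (m : ℝ) ^ 2)) :=
      calc postVar γ z m x ≤ ∑ x ∈ Z, postVar γ z m x :=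
            Finset.single_le_sum (f := fun x => postVar γ z m x)
              (fun _ _ => postVar_nonneg hγ) hx
        _ ≤ c * postVar γ z m (z m) := (hn t ht).2
        _ ≤ _ := by
          gcongr
          exact postVar_le_of_visits hγ
    have h5 : 1 ≤ (κ + J * (m : ℝ) ^ 2) *
        (c * (1 / (1 + visits z m (z m) * (m : ℝ) ^ 2))) := by
      refine h1.trans (mul_le_mul (by gcongr) h4 (postVar_nonneg hγ) (by positivity))
    have h6 : (1 : ℝ) + visits z m (z m) * (m : ℝ) ^ 2 ≤ c * (κ + J * (m : ℝ) ^ 2) := by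
      have : (κ + J * (m : ℝ) ^ 2) * (c * (1 / (1 + visits z m (z m) * (m : ℝ) ^ 2))) =
          c * (κ + J * (m : ℝ) ^ 2) / (1 + visits z m (z m) * (m : ℝ) ^ 2) := by ring
      rw [this, one_le_div (by positivity)] at h5
      exact h5
    have hm1 : (1 : ℝ) ≤ (m : ℝ) ^ 2 := one_le_pow₀ (by exact_mod_cast hm)
    have h7 : (visits z m (z m) : ℝ) * (m : ℝ) ^ 2 ≤ B * (m : ℝ) ^ 2 := by
      have : c * κ ≤ c * κ * (m : ℝ) ^ 2 := le_mul_of_one_le_right (by positivity) hm1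
      simp only [B]
      nlinarith
    exact le_of_mul_le_mul_right h7 (by positivity)
  -- A point `x'` is picked at most `⌊B⌋ + 1` times, as its number of visits grows at each pick.
  have hfiber : ∀ x' ∈ Z,
      ((Finset.Ico 1 (τ + 1)).filter fun t => z (idx N t (n t)) = x').card ≤ ⌊B⌋₊ + 1 := by
    intro x' _
    rw [← Finset.card_range (⌊B⌋₊ + 1)]
    refine Finset.card_le_card_of_injOn (fun t => visits z (idx N t (n t)) x')
      (fun t ht => ?_) ?_
    · simp only [Finset.coe_filter, Set.mem_ofPred_eq, Finset.mem_Ico] at ht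
      obtain ⟨⟨ht1, htτ⟩, rfl⟩ := ht
      simpa [Nat.lt_succ_iff] using Nat.le_floor (hpick t ht1 htτ)
    · have hlt : ∀ s t, 1 ≤ s → s < t → z (idx N s (n s)) = x' →
          visits z (idx N s (n s)) x' < visits z (idx N t (n t)) x' := by
        rintro s t hs hst rfl
        exact visits_lt_visits ((idx_lt_idx hs (hn s hs).1 hst).trans_le (by simp [idx]))
      intro s hs t ht hst
      simp only [Finset.coe_filter, Set.mem_ofPred_eq, Finset.mem_Ico] at hs ht hst
      rcases lt_trichotomy s t with h | h | h
      · exact absurd hst (hlt s t hs.1.1 h hs.2).ne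
      · exact h
      · exact absurd hst (hlt t s ht.1.1 h ht.2).ne'
  have hcount := Finset.card_le_mul_card_image_of_maps_to
    (s := Finset.Ico 1 (τ + 1)) (f := fun t => z (idx N t (n t))) (fun t _ => hz _) _ hfiber
  rw [Nat.card_Ico, Nat.add_sub_cancel] at hcount
  have h8 : (τ : ℝ) ≤ (⌊B⌋₊ + 1) * c := by
    simpa [c] using (Nat.cast_le (α := ℝ)).mpr hcount
  have h9 : (⌊B⌋₊ : ℝ) ≤ B := Nat.floor_le hB
  have h10 : (τ : ℝ) ≤ (B + 1) * c := h8.trans (by gcongr)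
  refine h10.trans ?_
  have : c * (c * (1 + κ) + 1) * (J + 1) - (B + 1) * c = c * (c * (κ * J + 1) + J) := by
    simp only [B]; ring
  have : 0 ≤ c * (c * (κ * J + 1) + J) := by positivity
  linarith

variable {H : Type*} [NormedAddCommGroup H] [InnerProductSpace ℝ H]
  {φ : StateAction d p → H} {g : StateAction d p → H} {m : ℕ} {x : StateAction d p}

open scoped Classical in
/-- The prediction error for noiseless observations of a function `e` on `Z`. -/
theorem sub_sum_weight_eq
    (hg : ∀ x ∈ Z, ∀ y ∈ Z, inner ℝ (g x) (φ y) = if x = y then (1 : ℝ) else 0)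
    (hz : ∀ i, z i ∈ Z) (hx : x ∈ Z) (e : StateAction d p → ℝ) :
    e x - ∑ i ∈ Finset.range m, e (z i) * weight γ z m x i =
      ∑ x' ∈ Z, e x' * inner ℝ (g x') (residual γ φ z m x) := by
  have h1 : ∀ x' ∈ Z, e x' * inner ℝ (g x') (residual γ φ z m x) =
      (if x' = x then e x' else 0) -
        ∑ i ∈ Finset.range m, (if x' = z i then e x' * weight γ z m x i else 0) := by
    intro x' hx'
    rw [residual, inner_sub_right, hg x' hx' x hx, inner_sum, mul_sub, Finset.mul_sum]
    congr 1
    · simp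
    · refine Finset.sum_congr rfl fun i _ => ?_
      rw [real_inner_smul_right, hg x' hx' _ (hz i)]
      simp
  rw [Finset.sum_congr rfl h1, Finset.sum_sub_distrib, Finset.sum_comm]
  simp [hx, hz]

/-- The weighted noise, gathered by the visited points. -/
theorem sum_mul_weight_eq (hφ : ∀ x y, inner ℝ (φ x) (φ y) = rbf γ x y) (hz : ∀ i, z i ∈ Z)
    (ξ : ℕ → ℝ) :
    ∑ i ∈ Finset.range m, ξ i * weight γ z m x i =
      ∑ x' ∈ Z, (∑ i ∈ Finset.range m, ({x'} : Set (StateAction d p)).indicator 1 (z i) * ξ i) *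
        ((m : ℝ) ^ 2 * inner ℝ (residual γ φ z m x) (φ x')) := by
  classical
  simp only [Finset.sum_mul]
  rw [Finset.sum_comm]
  refine Finset.sum_congr rfl fun i hi => ?_
  have hi' := Finset.mem_range.mp hi
  rw [Finset.sum_eq_single (z i)]
  · rw [inner_residual_sample hφ hi', ← mul_assoc ((m : ℝ) ^ 2), sq_mul_reg (by omega)]
    simp
  · intro x' _ hne
    simp [Set.indicator, hne.symm]
  · exact fun h => absurd (hz i) h

theorem tendsto_zero_of_le_mul_add {u a b : ℕ → ℝ} (hu : ∀ n, 0 ≤ u n)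
    (ha : Tendsto a atTop (𝓝 0)) (hb : Tendsto b atTop (𝓝 0))
    (h : ∀ᶠ n in atTop, u (n + 1) ≤ a n * u n + b n) : Tendsto u atTop (𝓝 0) := by
  refine tendsto_order.mpr ⟨fun δ hδ => Eventually.of_forall fun n => hδ.trans_le (hu n),
    fun δ hδ => ?_⟩
  obtain ⟨n₀, hn₀⟩ := eventually_atTop.mp (h.and ((ha.eventually_le_const one_half_pos).and
    (hb.eventually_le_const (show (0 : ℝ) < δ / 4 by positivity))))
  have hk : ∀ k, u (n₀ + k) ≤ u n₀ * (1 / 2) ^ k + δ / 2 := by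
    intro k
    induction k with
    | zero => simpa using (half_pos hδ).le
    | succ k ih =>
      obtain ⟨h1, h2, h3⟩ := hn₀ (n₀ + k) (by omega)
      have h4 : a (n₀ + k) * u (n₀ + k) ≤ 1 / 2 * u (n₀ + k) :=
        mul_le_mul_of_nonneg_right h2 (hu _)
      rw [← add_assoc, pow_succ]
      linarith
  have hlim : Tendsto (fun k : ℕ => u n₀ * (1 / 2 : ℝ) ^ k + δ / 2) atTop (𝓝 (δ / 2)) := by
    simpa using ((tendsto_pow_atTop_nhds_zero_of_lt_one (r := (1 / 2 : ℝ)) (by norm_num)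
      (by norm_num)).const_mul (u n₀)).add_const (δ / 2)
  obtain ⟨k₀, hk₀⟩ := eventually_atTop.mp (hlim.eventually_lt_const (half_lt_self hδ))
  filter_upwards [eventually_ge_atTop (n₀ + k₀)] with n hn
  have := hk (n - n₀)
  rw [Nat.add_sub_cancel' (by omega)] at this
  exact this.trans_lt (hk₀ _ (by omega))

theorem idx_eq_idx_succ {τ : ℕ} (hτ : 1 ≤ τ) : idx N τ N = idx N (τ + 1) 0 := by
  obtain ⟨t, rfl⟩ := Nat.exists_eq_add_of_le' hτ
  simp only [idx, Nat.add_sub_cancel]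
  ring

/-- The error of the prior of the next episode is the smoothing error of the current one plus a
weighted sum of the noise. -/
theorem episodePrior_succ_sub {p0 f : StateAction d p → Vec d} {y w : ℕ → Vec d}
    (hy : ∀ i, y i = f (z i) + w i) {τ : ℕ} (hτ : 1 ≤ τ) (l : Fin d) :
    episodePrior N γ p0 z y (τ + 1) x l - f x l =
      ((episodePrior N γ p0 z y τ x l - f x l) -
        ∑ i ∈ Finset.range (idx N (τ + 1) 0),
          (episodePrior N γ p0 z y τ (z i) l - f (z i) l) *
            weight γ z (idx N (τ + 1) 0) x i) +
      ∑ i ∈ Finset.range (idx N (τ + 1) 0), w i l * weight γ z (idx N (τ + 1) 0) x i := by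
  obtain ⟨t, rfl⟩ := Nat.exists_eq_add_of_le' hτ
  rw [← idx_eq_idx_succ hτ]
  simp only [episodePrior, postMean]
  rw [dotProduct_precision fun i => y i l - episodePrior N γ p0 z y (t + 1) (z i) l]
  have h : ∀ i, (y i l - episodePrior N γ p0 z y (t + 1) (z i) l) *
        weight γ z (idx N (t + 1) N) x i =
      w i l * weight γ z (idx N (t + 1) N) x i -
        (episodePrior N γ p0 z y (t + 1) (z i) l - f (z i) l) *
          weight γ z (idx N (t + 1) N) x i := by
    intro i
    rw [hy, PiLp.add_apply]
    ring
  simp only [h, Finset.sum_sub_distrib]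
  ring

theorem tendsto_predMean (hN : 1 ≤ N) (hγ : 0 < γ) (hZ : Z.Nonempty) (hz : ∀ i, z i ∈ Z)
    (hav : AboveAverage Z N γ z) {p0 f : StateAction d p → Vec d} {y w : ℕ → Vec d}
    (hy : ∀ i, y i = f (z i) + w i)
    (hnoise : ∀ x ∈ Z, ∀ l, Tendsto (fun n : ℕ => (n : ℝ)⁻¹ *
      ∑ i ∈ Finset.range n, ({x} : Set (StateAction d p)).indicator 1 (z i) * w i l)
      atTop (𝓝 0)) (hx : x ∈ Z) :
    Tendsto (fun τ => predMean N γ p0 z y τ 0 x) atTop (𝓝 (f x)) := by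
  classical
  obtain ⟨φ, hφ⟩ := exists_featureMap d p hγ
  obtain ⟨g, hg⟩ := exists_dual hγ hφ Z
  obtain ⟨K, hK, hvis⟩ := exists_visits_ge hγ hZ hz hav
  set G : ℝ := ∑ x ∈ Z, ‖g x‖
  have hG : 0 ≤ G := Finset.sum_nonneg fun _ _ => norm_nonneg _
  have hN0 : (0 : ℝ) < N := by exact_mod_cast hN
  suffices hl : ∀ l, Tendsto (fun τ => ∑ x ∈ Z, |episodePrior N γ p0 z y τ x l - f x l|)
      atTop (𝓝 0) by
    have hcoord : Tendsto (fun τ => (predMean N γ p0 z y τ 0 x).ofLp) atTop (𝓝 (f x).ofLp) := by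
      refine tendsto_pi_nhds.mpr fun l => ?_
      rw [tendsto_iff_norm_sub_tendsto_zero]
      refine squeeze_zero (fun _ => norm_nonneg _) (fun τ => ?_) (hl l)
      rw [Real.norm_eq_abs, predMean, if_pos rfl]
      exact Finset.single_le_sum (f := fun x => |episodePrior N γ p0 z y τ x l - f x l|)
        (fun _ _ => abs_nonneg _) hx
    exact ((PiLp.continuous_toLp 2 _).tendsto _).comp hcoord
  intro l
  set R : StateAction d p → ℕ → ℝ := fun x n =>
    ∑ i ∈ Finset.range n, ({x} : Set (StateAction d p)).indicator 1 (z i) * w i l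
  have hm : ∀ τ : ℕ, ((idx N (τ + 1) 0 : ℕ) : ℝ) = τ * N := fun τ => by simp [idx]
  have htop : Tendsto (fun τ => idx N (τ + 1) 0) atTop atTop := by
    refine tendsto_atTop_mono (fun τ => ?_) tendsto_id
    simpa [idx] using Nat.le_mul_of_pos_right τ hN
  refine tendsto_zero_of_le_mul_add
    (a := fun τ => Z.card * G * (1 / ((idx N (τ + 1) 0 : ℕ) : ℝ)))
    (b := fun τ => Z.card * (2 * K * N *
      ∑ x ∈ Z, |((idx N (τ + 1) 0 : ℕ) : ℝ)⁻¹ * R x (idx N (τ + 1) 0)|))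
    (fun τ => Finset.sum_nonneg fun _ _ => abs_nonneg _) ?_ ?_ ?_
  · simpa using (tendsto_one_div_atTop_nhds_zero_nat.comp htop).const_mul (Z.card * G)
  · have h1 : Tendsto (fun τ => ∑ x ∈ Z,
        |((idx N (τ + 1) 0 : ℕ) : ℝ)⁻¹ * R x (idx N (τ + 1) 0)|) atTop (𝓝 0) := by
      have h2 := tendsto_finsetSum Z fun x hx => ((hnoise x hx l).comp htop).abs
      simpa only [Function.comp_def, abs_zero, Finset.sum_const_zero] using h2
    simpa using (h1.const_mul (2 * K * N)).const_mul (Z.card : ℝ)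
  · filter_upwards [eventually_ge_atTop 1, eventually_ge_atTop ⌈2 * K⌉₊] with τ hτ hτK
    set M := idx N (τ + 1) 0
    have hM : (M : ℝ) = τ * N := hm τ
    have hτ0 : (0 : ℝ) < τ := by exact_mod_cast hτ
    have hM0 : (0 : ℝ) < M := by rw [hM]; positivity
    have hM0' : 0 < M := by exact_mod_cast hM0
    have hτK' : 2 * K ≤ τ := Nat.ceil_le.mp hτK
    -- `τ ≤ K * (j + 1)` and `2 * K ≤ τ` bound the number `j` of visits from below.
    have hJ : ∀ x ∈ Z, (τ : ℝ) / (2 * K) ≤ visits z M x := by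
      intro x hx
      rw [div_le_iff₀ (by positivity)]
      have := hvis τ x hx
      linarith
    have hJ1 : 1 ≤ (τ : ℝ) / (2 * K) := by
      rw [one_le_div (by positivity)]
      exact hτK'
    have hres : ∀ x ∈ Z, ‖residual γ φ z M x‖ ≤ 1 / M := by
      intro x hx
      refine abs_le_of_sq_le_sq' ?_ (by positivity) |>.2
      have h1 : ‖residual γ φ z M x‖ ^ 2 ≤ postVar γ z M x := by
        rw [postVar_eq hφ]
        exact le_add_of_nonneg_right
          (mul_nonneg (reg_nonneg _) (Finset.sum_nonneg fun _ _ => sq_nonneg _))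
      refine h1.trans ((postVar_le_of_visits hγ).trans ?_)
      rw [one_div_pow]
      have := hJ1.trans (hJ x hx)
      gcongr
      nlinarith [sq_nonneg (M : ℝ)]
    have hpoint : ∀ x ∈ Z, |episodePrior N γ p0 z y (τ + 1) x l - f x l| ≤
        G * (1 / M) * ∑ x ∈ Z, |episodePrior N γ p0 z y τ x l - f x l| +
          2 * K * N * ∑ x ∈ Z, |(M : ℝ)⁻¹ * R x M| := by
      intro x hx
      rw [episodePrior_succ_sub hy hτ,
        sub_sum_weight_eq hg hz hx fun x => episodePrior N γ p0 z y τ x l - f x l,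
        sum_mul_weight_eq hφ hz fun i => w i l]
      refine (abs_add_le _ _).trans (add_le_add ?_ ?_)
      · rw [Finset.mul_sum]
        refine (Finset.abs_sum_le_sum_abs _ _).trans (Finset.sum_le_sum fun x' hx' => ?_)
        rw [abs_mul, mul_comm]
        refine mul_le_mul_of_nonneg_right ?_ (abs_nonneg _)
        refine (abs_real_inner_le_norm _ _).trans
          (mul_le_mul ?_ (hres x hx) (norm_nonneg _) hG)
        exact Finset.single_le_sum (f := fun x => ‖g x‖) (fun _ _ => norm_nonneg _) hx'
      · rw [Finset.mul_sum]
        refine (Finset.abs_sum_le_sum_abs _ _).trans (Finset.sum_le_sum fun x' hx' => ?_)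
        have h1 := abs_inner_residual_le hγ hφ hM0' (by positivity) (hJ x' hx') (hJ x hx)
        have h2 : 2 * K * N * |(M : ℝ)⁻¹ * R x' M| = |R x' M| * (1 / (τ / (2 * K))) := by
          rw [abs_mul, abs_of_pos (inv_pos.mpr hM0), hM]
          field_simp
        rw [h2, abs_mul, abs_mul, abs_of_nonneg (sq_nonneg (M : ℝ))]
        exact mul_le_mul_of_nonneg_left h1 (abs_nonneg _)
    refine (Finset.sum_le_sum hpoint).trans (le_of_eq ?_)
    rw [Finset.sum_const, nsmul_eq_mul]
    ring

end Consistency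

end ActiveGP

theorem theorem1 {d p : ℕ} (N : ℕ) (hN : 1 ≤ N) (γ : ℝ) (hγ : 0 < γ)
    (X : Finset (Vec d)) (U : Finset (Vec p)) (hZ : (X ×ˢ U).Nonempty)
    (f p0 : StateAction d p → Vec d) (β : ℕ → ℕ → ℝ) (hβ : ∀ τ n, 0 ≤ β τ n)
    {Ω : Type*} [mΩ : MeasurableSpace Ω] (P : Measure Ω) [IsProbabilityMeasure P]
    (ℱ : Filtration ℕ mΩ)
    -- the sampled points and the observation noise
    (z : ℕ → Ω → StateAction d p) (w : ℕ → Ω → Vec d)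
    (hz : ∀ j, Measurable[ℱ j] (z j))
    (hw : ∀ j, Measurable[ℱ (j + 1)] (w j))
    (hind : ∀ j, Indep (MeasurableSpace.comap (w j) inferInstance) (ℱ j) P)
    (v : ℕ → ℝ≥0) (hv : BddAbove (Set.range v))
    (hlaw : ∀ j, P.map (w j) =
      multivariateGaussian 0 ((v j : ℝ) • (1 : Matrix (Fin d) (Fin d) ℝ)))
    -- the observations
    (y : ℕ → Ω → Vec d) (hy : ∀ j ω, y j ω = f (z j ω) + w j ω) :
    (∀ ω, IsUCBRun X U N γ p0 β (fun j => z j ω) (fun j => y j ω) →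
      AboveAverage (X ×ˢ U) N γ (fun j => z j ω) →
        Tendsto (fun τ => (X ×ˢ U).sup' hZ (predVar N γ (fun j => z j ω) τ 0)) atTop (𝓝 0) ∧
        ∀ ε : ℝ, 0 < ε → ∀ τ : ℕ, 1 ≤ τ → (3 ≤ τ ∨ 3 ≤ (X ×ˢ U).card) →
          episodeBound (X ×ˢ U).card N ε ≤ τ →
            (X ×ˢ U).sup' hZ (predVar N γ (fun j => z j ω) τ 0) ≤ ε) ∧
    (∀ B : ℝ,
      (∀ l, MemRKHSBall (fun s t : ↥(X ×ˢ U) => rbf γ s.1 t.1) B (fun s => f s.1 l)) →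
        ∀ᵐ ω ∂P, IsUCBRun X U N γ p0 β (fun j => z j ω) (fun j => y j ω) →
          AboveAverage (X ×ˢ U) N γ (fun j => z j ω) →
            ∀ zs ∈ X ×ˢ U,
              Tendsto (fun τ => predMean N γ p0 (fun j => z j ω) (fun j => y j ω) τ 0 zs)
                atTop (𝓝 (f zs))) := by
  refine ⟨fun ω hrun hav => ?_, fun B _ => ?_⟩
  · have hmem := hrun.sample_mem hN
    exact ⟨tendsto_sup'_predVar hN hγ hZ hmem hav, fun ε hε τ _ h3 hτ =>
      Finset.sup'_le _ _ fun x hx =>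
        predVar_le_of_episodeBound_le hN hγ hZ hmem hav hε h3 hτ hx⟩
  · have hnoise : ∀ᵐ ω ∂P, ∀ x ∈ X ×ˢ U, ∀ l, Tendsto (fun n : ℕ => (n : ℝ)⁻¹ *
        ∑ i ∈ Finset.range n, ({x} : Set (StateAction d p)).indicator 1 (z i ω) * w i ω l)
        atTop (𝓝 0) := by
      rw [Filter.eventually_all_finset]
      exact fun x _ => ae_all_iff.mpr fun l => ae_tendsto_noise_average hz hw hind hv hlaw x l
    filter_upwards [hnoise] with ω hω hrun hav zs hzs
    exact tendsto_predMean hN hγ hZ (hrun.sample_mem hN) hav (fun i => hy i ω) hω hzs
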